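/- Let $p>2$ be a prime, $k$ a perfect field of characteristic $p$, $K_0=W(k)[1/p]$, and $K/K_0$ a finite totally ramified extension with uniformiser $\pi$ and Eisenstein polynomial $E(u)\in W(k)[u]$; write $E(0)=p\,c_0$ with $c_0\in W(k)^\times$. Let $\bar K$ be an algebraic closure of $K$ with ring of integers $\mathcal O_{\bar K}$, let $R=\varprojlim_{x\mapsto x^p}\mathcal O_{\bar K}/p$, let $\varphi$ be the Frobenius of $W(R)$, and let $\theta:W(R)\to\widehat{\mathcal O}_{\bar K}$ be Fontaine's map to the $p$-adic completion of $\mathcal O_{\bar K}$. Let $A_{\mathrm{cris}}$ be the $p$-adic completion of the divided power envelope of $W(R)$ with respect to $\operatorname{Ker}\theta$, and $B^+_{\mathrm{cris}}=A_{\mathrm{cris}}[1/p]$. Choose $\pi_n\in\bar K$ with $\pi_0=\pi$ and $\pi_{n+1}^p=\pi_n$, put $\underline\pi=(\pi_n \bmod p)_{n\ge 0}\in R$, and embed $\mathfrak S=W(k)[\![u]\!]$ into $W(R)$ by $u\mapsto[\underline\pi]$. Let $\mathcal O_{\mathcal E}\subset W(\operatorname{Fr}R)$ be the $p$-adic completion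 of $\mathfrak S[1/u]$, $\mathcal E=\mathcal O_{\mathcal E}[1/p]$, $\mathcal O^{\mathrm{ur}}$ the ring of integers of the maximal unramified extension of $\mathcal E$ in $W(\operatorname{Fr}R)[1/p]$, $\widehat{\mathcal O^{\mathrm{ur}}}$ its $p$-adic completion, and $\mathfrak S^{\mathrm{ur}}=\widehat{\mathcal O^{\mathrm{ur}}}\cap W(R)$. For $r\ge 0$ put $\operatorname{Fil}^rW(R)=(\operatorname{Ker}\theta)^r$ and $I^{[r]}W(R)=\{x\in W(R) : \varphi^n(x)\in\operatorname{Fil}^rW(R)\text{ for all } n\ge 0\}$. Let $\mathfrak t\in\mathfrak S^{\mathrm{ur}}$ be an element that is not divisible by $p$ in $W(R)$ and satisfies $\varphi(\mathfrak t)=c_0^{-1}E(u)\,\mathfrak t$. Then for every integer $r\ge 0$: 1. if $a\in B^+_{\mathrm{cris}}$ and $\varphi(\mathfrak t)^r a\in W(R)$, then $a\in W(R)$; 2. the ideal $I^{[r]}W(R)$ of $W(R)$ is generated by $\varphi(\mathfrak t)^r$. -/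

import Mathlib

open Polynomial

universe u v

namespace PadicHodge

section Theta

variable (O : Type v) [CommRing O] (p : ℕ) [Fact p.Prime] [Fact (¬ IsUnit (p : O))]

/-- The ring `W(R)` of Witt vectors of `R = lim O/p` (transition maps: Frobenius). With
`O` the ring of integers of an algebraic closure of a `p`-adic field, `PreTilt O p` is
Fontaine's ring `R`. -/
abbrev WR : Type v := WittVector p (PreTilt O p)

/-- The map `W(R) → O / p^(n+1)`,
`(x₀, x₁, …) ↦ ∑_{i ≤ n} p^i y_i ^ (p^(n-i))`, where `y_i` is any lift to `O` of the `n`-th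
component in `O / p` of `x_i ∈ R`. -/
noncomputable def thetaModPPow (n : ℕ) : WR O p →+* O ⧸ Ideal.span {(p : O)} ^ (n + 1) :=
  (WittVector.ghostComponentModPPow n).comp (WittVector.map (PreTilt.coeff n))

variable {O p} in
theorem thetaModPPow_teichmuller (n : ℕ) (x : PreTilt O p) (y : O)
    (hy : Ideal.Quotient.mk (Ideal.span {(p : O)}) y = PreTilt.coeff n x) :
    thetaModPPow O p n (WittVector.teichmuller p x) = Ideal.Quotient.mk _ (y ^ p ^ n) := by
  simp only [thetaModPPow, RingHom.comp_apply, WittVector.map_teichmuller]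
  rw [← hy, ← WittVector.map_teichmuller, WittVector.ghostComponentModPPow_map_mk,
    WittVector.ghostComponent_teichmuller]

theorem factorPow_comp_thetaModPPow {m n : ℕ} (h : m ≤ n) :
    (Ideal.Quotient.factorPow (Ideal.span {(p : O)}) (Nat.succ_le_succ h)).comp
      (thetaModPPow O p n) = thetaModPPow O p m := by
  apply WittVector.eq_of_apply_teichmuller_eq
  · refine ⟨m + 1, ?_⟩
    have : (p : O ⧸ Ideal.span {(p : O)} ^ (m + 1)) = Ideal.Quotient.mk _ (p : O) := by
      simp [map_natCast]
    rw [this, ← map_pow, Ideal.Quotient.eq_zero_iff_mem]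
    exact Ideal.pow_mem_pow (Ideal.mem_span_singleton_self _) _
  · intro x
    obtain ⟨a, ha⟩ := Ideal.Quotient.mk_surjective (PreTilt.coeff n x)
    have hb : Ideal.Quotient.mk (Ideal.span {(p : O)}) (a ^ p ^ (n - m)) = PreTilt.coeff m x := by
      rw [map_pow, ha]
      obtain ⟨d, rfl⟩ := Nat.exists_eq_add_of_le h
      rw [Nat.add_sub_cancel_left]
      clear ha h
      induction d with
      | zero => simp
      | succ d ih => rw [pow_succ' p d, pow_mul, ← add_assoc, PreTilt.coeff_pow_p, ih]
    rw [RingHom.comp_apply, thetaModPPow_teichmuller n x a ha, thetaModPPow_teichmuller m x _ hb,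
      ← pow_mul, ← pow_add, Nat.sub_add_cancel h]
    rfl

theorem theta_compat {m n : ℕ} (h : m ≤ n) :
    (Ideal.Quotient.factorPow (Ideal.span {(p : O)}) h).comp
      ((Ideal.Quotient.factorPow (Ideal.span {(p : O)}) (Nat.le_succ n)).comp
        (thetaModPPow O p n)) =
      (Ideal.Quotient.factorPow (Ideal.span {(p : O)}) (Nat.le_succ m)).comp
        (thetaModPPow O p m) := by
  rw [← factorPow_comp_thetaModPPow O p h, ← RingHom.comp_assoc, ← RingHom.comp_assoc]
  congr 1
  apply Ideal.Quotient.ringHom_ext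
  rfl

/-- Fontaine's map `θ : W(R) → Ô`, with `Ô` the `p`-adic completion of `O`. It is the ring
homomorphism lifting the projection `R → O / p` onto the first factor. -/
noncomputable def theta : WR O p →+* AdicCompletion (Ideal.span {(p : O)}) O :=
  AdicCompletion.liftRingHom (Ideal.span {(p : O)})
    (fun n => (Ideal.Quotient.factorPow (Ideal.span {(p : O)}) (Nat.le_succ n)).comp
      (thetaModPPow O p n))
    (theta_compat O p)

/-- `Fil^r W(R) = (Ker θ)^r`. -/
noncomputable def filW (r : ℕ) : Ideal (WR O p) := RingHom.ker (theta O p) ^ r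

/-- Fontaine's ideal `I^{[r]} W(R) = {x ∈ W(R) | φ^n(x) ∈ Fil^r W(R) for all n ≥ 0}`. -/
noncomputable def idealI (r : ℕ) : Ideal (WR O p) :=
  ⨅ n : ℕ, (filW O p r).comap ((WittVector.frobenius : WR O p →+* WR O p) ^ n)

/-- The divided power envelope of `W(R)` with respect to `Ker θ`: the `W(R)`-subalgebra of
`W(R)[1/p]` generated by the divided powers `x^n / n!`, for `x ∈ Ker θ` and `n ≥ 0`. -/
noncomputable def AcrisZero : Subalgebra (WR O p) (Localization.Away (p : WR O p)) :=
  Algebra.adjoin (WR O p)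
    {z | ∃ x ∈ RingHom.ker (theta O p), ∃ n : ℕ,
      (n.factorial : Localization.Away (p : WR O p)) * z = algebraMap (WR O p) _ x ^ n}

/-- `A_cris`, the `p`-adic completion of the divided power envelope of `W(R)` with respect to
`Ker θ`. -/
abbrev Acris : Type v :=
  AdicCompletion (Ideal.span {(p : AcrisZero O p)}) (AcrisZero O p)

/-- `B⁺_cris = A_cris[1/p]`. -/
abbrev BcrisPlus : Type v := Localization.Away (p : Acris O p)

/-- The canonical map `W(R) → B⁺_cris`. -/
noncomputable def toBcrisPlus : WR O p →+* BcrisPlus O p :=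
  (algebraMap (Acris O p) (BcrisPlus O p)).comp
    ((algebraMap (AcrisZero O p) (Acris O p)).comp (algebraMap (WR O p) (AcrisZero O p)))

/-- `W(Fr R)`, with `Fr R` the field of fractions of `R`. -/
abbrev WFrR : Type v := WittVector p (FractionRing (PreTilt O p))

/-- The inclusion `W(R) → W(Fr R)`. -/
noncomputable def toWFrR : WR O p →+* WFrR O p :=
  WittVector.map (algebraMap (PreTilt O p) (FractionRing (PreTilt O p)))

end Theta

section Embedding

variable {p : ℕ} [Fact p.Prime] {k : Type u} [Field k] [CharP k p] [PerfectRing k p]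
variable {O : Type v} [CommRing O] [Fact (¬ IsUnit (p : O))] [Algebra (WittVector p k) O]

variable (p k O) in
/-- The map `k = W(k)/p → O/p` induced by the structure map `W(k) → O`. -/
noncomputable def residueMap : k →+* ModP O p :=
  (Ideal.Quotient.lift (Ideal.span {(p : WittVector p k)})
    ((Ideal.Quotient.mk (Ideal.span {(p : O)})).comp (algebraMap (WittVector p k) O))
    (fun a ha => by
      obtain ⟨b, rfl⟩ := Ideal.mem_span_singleton.mp ha
      rw [RingHom.comp_apply, Ideal.Quotient.eq_zero_iff_mem, map_mul, map_natCast]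
      exact Ideal.mul_mem_right _ _ (Ideal.mem_span_singleton_self _))).comp
    (WittVector.quotientPEquiv (p := p) (k := k)).symm.toRingHom

variable (p k O) in
/-- The embedding `k → R`, `a ↦ (a^{1/p^n} mod p)_n`. -/
noncomputable def embk : k →+* PreTilt O p :=
  Perfection.lift p k (ModP O p) (residueMap p k O)

variable (p k O) in
/-- The embedding `W(k) → W(R)` induced by `k → R`, that makes `W(R)` a `W(k)`-algebra. -/
noncomputable def embWk : WittVector p k →+* WR O p :=
  WittVector.map (embk p k O)

/-- The element `(ϖ_n mod p)_n` of `R` given by a compatible system of `p`-power roots. -/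
def tiltElem (ϖ : ℕ → O) (h : ∀ n, ϖ (n + 1) ^ p = ϖ n) : PreTilt O p :=
  ⟨fun n => Ideal.Quotient.mk _ (ϖ n), fun n => by rw [← map_pow, h n]⟩

/-- The image of a polynomial `f(u) ∈ W(k)[u]` in `W(R)` under `u ↦ [ϖ]`. -/
noncomputable def evalPoly (x : PreTilt O p) (f : (WittVector p k)[X]) : WR O p :=
  f.eval₂ (embWk p k O) (WittVector.teichmuller p x)

variable (p k) in
/-- The image of `𝔖 = W(k)⟦u⟧` in `W(R)` under `u ↦ [x]`: an element `y` is the value at `[x]` of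
`f = ∑ a_n u^n` when it is the limit of the partial sums `∑_{n < N} a_n [x]^n`, that is, congruent
to the `N`-th one modulo `[x]^N` for every `N`. -/
def imageS (x : PreTilt O p) : Set (WR O p) :=
  {y | ∃ f : PowerSeries (WittVector p k), ∀ N : ℕ,
    WittVector.teichmuller p x ^ N ∣ y - evalPoly x (PowerSeries.trunc N f)}

/-- The closure of a subring for the `p`-adic topology. -/
def padicClosure {A : Type v} [CommRing A] (p : ℕ) (S : Subring A) : Subring A where
  carrier := {x | ∀ n : ℕ, ∃ y ∈ S, (p : A) ^ n ∣ x - y}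
  zero_mem' n := ⟨0, S.zero_mem, by simp⟩
  one_mem' n := ⟨1, S.one_mem, by simp⟩
  add_mem' {a b} ha hb n := by
    obtain ⟨x, hx, hx'⟩ := ha n
    obtain ⟨y, hy, hy'⟩ := hb n
    refine ⟨x + y, S.add_mem hx hy, ?_⟩
    have := dvd_add hx' hy'
    rwa [show a - x + (b - y) = a + b - (x + y) by ring] at this
  neg_mem' {a} ha n := by
    obtain ⟨x, hx, hx'⟩ := ha n
    refine ⟨-x, S.neg_mem hx, ?_⟩
    rw [show -a - -x = -(a - x) by ring]
    exact (dvd_neg).mpr hx'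
  mul_mem' {a b} ha hb n := by
    obtain ⟨x, hx, hx'⟩ := ha n
    obtain ⟨y, hy, hy'⟩ := hb n
    refine ⟨x * y, S.mul_mem hx hy, ?_⟩
    rw [show a * b - x * y = (a - x) * b + x * (b - y) by ring]
    exact dvd_add (Dvd.dvd.mul_right hx' b) (Dvd.dvd.mul_left hy' x)

variable (p k) in
/-- `𝒪_ℰ`, the `p`-adic completion of `𝔖[1/u]`, as a subring of `W(Fr R)`: the `p`-adic closure
of the subring generated by `𝔖` and the inverse of `u = [x]`. -/
noncomputable def OE (x : PreTilt O p) : Subring (WFrR O p) :=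
  padicClosure p (Subring.closure
    (toWFrR O p '' imageS p k x ∪ {y | toWFrR O p (WittVector.teichmuller p x) * y = 1}))

variable (p k) in
/-- `𝒪^ur`, the ring of integers of the maximal unramified extension of `ℰ = Frac 𝒪_ℰ` inside
`W(Fr R)[1/p]`: the compositum of the rings of integers of all finite unramified extensions, which
are the finite étale `𝒪_ℰ`-subalgebras of `W(Fr R)`. -/
noncomputable def Our (x : PreTilt O p) : Subring (WFrR O p) :=
  sSup {C | ∃ B : Subalgebra (OE p k x) (WFrR O p),
    Module.Finite (OE p k x) B ∧ Algebra.Etale (OE p k x) B ∧ C = B.toSubring}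

variable (p k) in
/-- `𝔖^ur`, the intersection in `W(Fr R)` of `W(R)` with the `p`-adic completion of `𝒪^ur`, as a
subring of `W(R)`. -/
noncomputable def Sur (x : PreTilt O p) : Subring (WR O p) :=
  (padicClosure p (Our p k x)).comap (toWFrR O p)

end Embedding

/-- `p` is not invertible in the integral closure of `W(k)` in an extension of `Frac W(k)`. -/
instance fact_not_isUnit_p {p : ℕ} [Fact p.Prime] {k : Type u} [Field k] [CharP k p]
    [PerfectRing k p] {L : Type v} [Field L] [Algebra (WittVector p k) L]
    [Algebra (FractionRing (WittVector p k)) L]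
    [IsScalarTower (WittVector p k) (FractionRing (WittVector p k)) L] :
    Fact (¬ IsUnit (p : integralClosure (WittVector p k) L)) := by
  refine ⟨fun h => ?_⟩
  have : FaithfulSMul (WittVector p k) L := by
    rw [faithfulSMul_iff_algebraMap_injective,
      IsScalarTower.algebraMap_eq (WittVector p k) (FractionRing (WittVector p k)) L]
    exact (algebraMap (FractionRing (WittVector p k)) L).injective.comp
      (IsFractionRing.injective _ _)
  rw [← map_natCast (algebraMap (WittVector p k) (integralClosure (WittVector p k) L))] at h
  exact (WittVector.irreducible p).not_isUnit (isUnit_of_map_unit _ _ h)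

/-- The ring of integers `𝒪_K̄` of the algebraic closure `K̄` of `K`, for `K` an extension of
`Frac W(k)`: the integral closure of `W(k)` in `K̄`. -/
noncomputable abbrev OKbar (p : ℕ) [Fact p.Prime] (k : Type u) [Field k] [CharP k p] (K : Type v) [Field K]
    [Algebra (WittVector p k) K] : Subalgebra (WittVector p k) (AlgebraicClosure K) :=
  integralClosure (WittVector p k) (AlgebraicClosure K)

end PadicHodge

/-! Put ξ = E([π]), with [π] the Teichmüller lift of the tilt element, and let ω ∈ R be the (deg
E)-th power of that element. The Eisenstein condition gives ξ = [ω] + pη with η a unit, and Ker θ =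
(ξ), so Fil^r consists of the multiples of ξ^r. Reducing φ(t) = c ξ t modulo p, with c = c₀⁻¹, shows
that τ = t mod p satisfies τ^(p-1) ~ ω.

The ideal I^[r]. Suppose ξ divides every φ^n(x). Iterating the equation of t gives φ^(n+1)(t) ∣ t
φ^n(x) (`frobenius_iterate_dvd`). Modulo p this bounds the valuation of x mod p below by p v(τ) -
v(τ)/p^n. Letting n grow gives τ^p ∣ x mod p (`coeff_zero_dvd`), so φ(t) divides x modulo p, and
successive p-adic approximation gives φ(t) ∣ x (`frobenius_t_dvd`). Higher r follow by induction
because t is regular modulo ξ. This rests on p ∈ (ξ, t), which is where p > 2 enters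
(`exists_p_mul_eq`).

Division in B⁺_cris. After clearing powers of p, let φ(t) a = x in A_cris with x ∈ W(R). The
uncompleted envelope is the lattice Λ = ∑ W(R) ξ^n/n! in W(R)[1/p], stable under φ and contained in
W(R) + ξ W(R)[1/p]. Applying φ^n to p-adic approximations of φ(t) a = x, and using ξ ∣ φ^(n+1)(t),
puts φ^n(x) in (ξ) + p^i W(R) for all i, hence in (ξ). So x = φ(t) y by the first part. Finally a =
y because φ(t) is a nonzerodivisor on A_cris (`mem_of_frobenius_t_mul_mem`): modulo ξ^m, t divides
p^m times a unit, so dividing by φ(t) costs a bounded power of p for each m, and Λ is ξ-adically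
closed (`mem_divPowSpan_of_forall`). -/

/-! ### The valuation on the integral closure of a complete discrete valuation ring. -/

open Filter Topology NNReal in
/-- A normed field whose closed unit ball is an adically complete ring is complete. -/
theorem completeSpace_of_isAdicComplete_unitBall {A F : Type*} [CommRing A] [NormedField F]
    [Algebra A F] (hball : ∀ x : F, ‖x‖ ≤ 1 ↔ ∃ a, algebraMap A F a = x) (q : A)
    (hq0 : algebraMap A F q ≠ 0) (hq1 : ‖algebraMap A F q‖ < 1)
    [IsAdicComplete (Ideal.span {q}) A] : CompleteSpace F := by
  have hqpos : 0 < ‖algebraMap A F q‖ := norm_pos_iff.mpr hq0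
  refine Metric.complete_of_cauchySeq_tendsto fun s hs => ?_
  -- A subsequence with increments below |q|^n has increments q^n c_n with c_n in `A`; it is thus a
  -- series that converges q-adically in `A`.
  obtain ⟨φ, hφ, hφs⟩ := hs.subseq_mem (V := fun n => {x | dist x.1 x.2 < ‖algebraMap A F q‖ ^ n})
    fun n => Metric.dist_mem_uniformity (pow_pos hqpos n)
  have hc : ∀ n, ∃ c : A, algebraMap A F (q ^ n * c) = s (φ (n + 1)) - s (φ n) := by
    intro n
    have h1 : ‖(s (φ (n + 1)) - s (φ n)) / algebraMap A F q ^ n‖ ≤ 1 := by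
      rw [norm_div, norm_pow, div_le_one (pow_pos hqpos n), ← dist_eq_norm]
      exact (hφs n).le
    obtain ⟨c, hc⟩ := (hball _).mp h1
    refine ⟨c, ?_⟩
    rw [map_mul, hc, map_pow, mul_div_cancel₀ _ (pow_ne_zero n hq0)]
  choose c hc using hc
  have hsum : ∀ n, algebraMap A F (∑ i ∈ Finset.range n, q ^ i * c i) = s (φ n) - s (φ 0) := by
    intro n
    rw [map_sum, Finset.sum_congr rfl fun i _ => hc i, Finset.sum_range_sub fun i => s (φ i)]
  obtain ⟨L, hL⟩ := IsPrecomplete.prec' (I := Ideal.span {q})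
    (fun n => ∑ i ∈ Finset.range n, q ^ i * c i) (by
      intro m n hmn
      rw [SModEq.sub_mem, smul_eq_mul, Ideal.mul_top, Ideal.span_singleton_pow,
        Ideal.mem_span_singleton, ← dvd_neg, neg_sub, Finset.sum_range_sub_sum_range hmn]
      refine Finset.dvd_sum fun i hi => Dvd.dvd.mul_right (pow_dvd_pow q ?_) _
      simp at hi; omega)
  refine ⟨s (φ 0) + algebraMap A F L, tendsto_nhds_of_cauchySeq_of_subseq hs hφ.tendsto_atTop ?_⟩
  rw [tendsto_iff_norm_sub_tendsto_zero]
  refine squeeze_zero (fun _ => norm_nonneg _) (fun n => ?_)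
    (tendsto_pow_atTop_nhds_zero_of_lt_one hqpos.le hq1)
  have := hL n
  rw [SModEq.sub_mem, smul_eq_mul, Ideal.mul_top, Ideal.span_singleton_pow,
    Ideal.mem_span_singleton] at this
  obtain ⟨d, hd⟩ := this
  have h2 : (s ∘ φ) n - (s (φ 0) + algebraMap A F L) = algebraMap A F q ^ n * algebraMap A F d := by
    rw [← map_pow, ← map_mul, ← hd, map_sub, hsum]; simp; ring
  rw [h2, norm_mul, norm_pow]
  exact mul_le_of_le_one_right (pow_nonneg hqpos.le n) ((hball _).mpr ⟨d, rfl⟩)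

open NNReal IsDedekindDomain in
/-- The integral closure of a complete discrete valuation ring in an algebraic extension of its
fraction field is the ring of integers of a valuation. -/
theorem exists_valuation_integers_integralClosure (A F L : Type*) [CommRing A] [IsDomain A]
    [IsDiscreteValuationRing A] [Field F] [Algebra A F] [IsFractionRing A F] [Field L]
    [Algebra A L] [Algebra F L] [IsScalarTower A F L] [Algebra.IsAlgebraic F L]
    (q : A) (hq : Irreducible q) [IsAdicComplete (Ideal.span {q}) A] :
    ∃ v : Valuation L ℝ≥0, v.Integers (integralClosure A L) := by
  let P : HeightOneSpectrum A := IsDiscreteValuationRing.maximalIdeal A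
  have hb : (1 : ℝ≥0) < 2 := by norm_num
  let abv : AbsoluteValue F ℝ := P.adicAbv hb
  let nf : NormedField F := abv.toNormedField
  have hnorm : ∀ x : F, ‖x‖ = abv x := fun _ => rfl
  have hball : ∀ x : F, ‖x‖ ≤ 1 ↔ ∃ a, algebraMap A F a = x := by
    intro x
    refine ⟨fun h => IsDiscreteValuationRing.exists_lift_of_le_one ?_, ?_⟩
    · rw [hnorm] at h
      have h' : P.adicAbvDef hb x ≤ 1 := h
      rw [HeightOneSpectrum.adicAbvDef, ← map_one (WithZeroMulInt.toNNReal (ne_zero_of_lt hb))] at h'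
      exact (WithZeroMulInt.toNNReal_strictMono hb).le_iff_le.mp h'
    · rintro ⟨a, rfl⟩
      exact P.adicAbv_coe_le_one hb a
  have hq0 : algebraMap A F q ≠ 0 := by
    simpa using hq.ne_zero
  have hq1 : ‖algebraMap A F q‖ < 1 := by
    rw [hnorm]
    refine (P.adicAbv_coe_lt_one_iff hb q).mpr ?_
    change q ∈ IsLocalRing.maximalIdeal A
    exact hq.not_isUnit
  let nnf : NontriviallyNormedField F :=
    { nf with
      non_trivial := ⟨(algebraMap A F q)⁻¹, by
        rw [norm_inv]
        exact (one_lt_inv₀ (norm_pos_iff.mpr hq0)).mpr hq1⟩ }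
  have : CompleteSpace F := completeSpace_of_isAdicComplete_unitBall hball q hq0 hq1
  have : IsUltrametricDist F :=
    IsUltrametricDist.isUltrametricDist_of_isNonarchimedean_norm (P.isNonarchimedean_adicAbv hb)
  let v : Valuation L ℝ≥0 :=
    { toFun := fun x => ⟨spectralNorm F L x, spectralNorm_nonneg x⟩
      map_zero' := by ext; exact spectralNorm_zero
      map_one' := by ext; exact spectralNorm_one
      map_mul' := fun x y => by ext; exact spectralAlgNorm_mul x y
      map_add_le_max' := fun x y => 
        le_max_iff.mpr (le_max_iff.mp (isNonarchimedean_spectralNorm (K := F) x y)) }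
  -- The spectral norm of x is at most 1 exactly when the coefficients of its minimal polynomial
  -- over `F` come from `A`; since `A` is integrally closed, this is integrality.
  have hv : ∀ x : L, v x ≤ 1 ↔ IsIntegral A x := by
    intro x
    have hx : IsIntegral F x := Algebra.IsIntegral.isIntegral x
    rw [← NNReal.coe_le_coe]
    change spectralValue (minpoly F x) ≤ 1 ↔ _
    rw [spectralValue_le_one_iff (minpoly.monic hx)]
    constructor
    · intro h
      have : (minpoly F x) ∈ Polynomial.lifts (algebraMap A F) := by
        rw [Polynomial.lifts_iff_coeff_lifts]
        exact fun n => (hball _).mp (h n)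
      obtain ⟨g, hg, -, hgm⟩ := Polynomial.lifts_and_natDegree_eq_and_monic this (minpoly.monic hx)
      refine ⟨g, hgm, ?_⟩
      rw [← Polynomial.aeval_def, ← Polynomial.aeval_map_algebraMap F, hg, minpoly.aeval]
    · intro h n
      rw [minpoly.isIntegrallyClosed_eq_field_fractions' F h, Polynomial.coeff_map]
      exact (hball _).mpr ⟨_, rfl⟩
  refine ⟨v, ⟨Subtype.val_injective, fun x => (hv _).mpr x.2, fun x hx => ⟨⟨x, (hv _).mp hx⟩, rfl⟩⟩⟩

namespace PadicHodge

/-! ### Divisibility in the tilt of a valuation ring. -/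

section Tilt

variable {O : Type v} [CommRing O] {p : ℕ} [Fact p.Prime] [Fact (¬ IsUnit (p : O))]

theorem PreTilt_coeff_pow_pow (x : PreTilt O p) (n : ℕ) :
    PreTilt.coeff n x ^ p ^ n = PreTilt.coeff 0 x := by
  induction n with
  | zero => simp
  | succ n ih => rw [pow_succ', pow_mul, PreTilt.coeff_pow_p, ih]

theorem PreTilt_ext {x y : PreTilt O p} (h : ∀ n, PreTilt.coeff n x = PreTilt.coeff n y) : x = y :=
  Perfection.ext h

theorem coeff_tiltElem (w : ℕ → O) (hw : ∀ n, w (n + 1) ^ p = w n) (n : ℕ) :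
    PreTilt.coeff n (tiltElem w hw) = Ideal.Quotient.mk _ (w n) := rfl

theorem tiltElem_pow (w : ℕ → O) (hw : ∀ n, w (n + 1) ^ p = w n) (e : ℕ) :
    tiltElem w hw ^ e = tiltElem (fun n => w n ^ e)
      (fun n => by rw [← pow_mul, mul_comm, pow_mul, hw]) := by
  refine PreTilt_ext fun n => ?_
  rw [map_pow, coeff_tiltElem, coeff_tiltElem, map_pow]

omit [Fact p.Prime] [Fact (¬ IsUnit (p : O))] in
theorem root_pow_eq (w : ℕ → O) (hw : ∀ n, w (n + 1) ^ p = w n) (n : ℕ) : w n ^ p ^ n = w 0 := by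
  induction n with
  | zero => simp
  | succ n ih => rw [pow_succ', pow_mul, hw, ih]

omit [Fact p.Prime] [Fact (¬ IsUnit (p : O))] in
theorem ModP_mk_eq_zero {a : O} : (Ideal.Quotient.mk _ a : ModP O p) = 0 ↔ (p : O) ∣ a := by
  rw [Ideal.Quotient.eq_zero_iff_mem, Ideal.mem_span_singleton]

/-- An element of the tilt whose image in `O / p` is a unit is a unit. -/
theorem PreTilt_isUnit_of_coeff_zero {x : PreTilt O p} (hx : IsUnit (PreTilt.coeff 0 x)) :
    IsUnit x := by
  have h : ∀ n, IsUnit (PreTilt.coeff n x) := fun n => by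
    rw [← PreTilt_coeff_pow_pow x n] at hx
    exact (isUnit_pow_iff (pow_ne_zero n (Fact.out : p.Prime).ne_zero)).mp hx
  let y : PreTilt O p := ⟨fun n => Ring.inverse (PreTilt.coeff n x), fun n => by
    beta_reduce
    rw [Ring.inverse_pow, PreTilt.coeff_pow_p]⟩
  refine IsUnit.of_mul_eq_one y (PreTilt_ext fun n => ?_)
  rw [map_mul, map_one]
  exact Ring.mul_inverse_cancel _ (h n)

theorem PreTilt_mem_jacobson_of_coeff_zero {x : PreTilt O p} (hx : PreTilt.coeff 0 x = 0) :
    x ∈ (⊥ : Ideal (PreTilt O p)).jacobson := by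
  rw [Ideal.mem_jacobson_bot]
  exact fun y => PreTilt_isUnit_of_coeff_zero (by simp [hx])

variable {L : Type*} [Field L] [Algebra O L] {v : Valuation L NNReal} (hv : v.Integers O)
include hv

theorem Integers_dvd_of_pow_dvd_pow {n : ℕ} (hn : n ≠ 0) {a b : O} (h : a ^ n ∣ b ^ n) : a ∣ b := by
  rw [← hv.le_iff_dvd] at h ⊢
  simpa [pow_le_pow_iff_left₀ _ _ hn] using h

variable {w : ℕ → O} (hw : ∀ n, w (n + 1) ^ p = w n) (hw0 : Associated (w 0) (p : O))
  (hp0 : (p : O) ≠ 0)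
include hw0 hp0

/-- An element of the tilt that vanishes in `O / p` is divisible by the element of the tilt given
by a system of roots of (an associate of) `p`. -/
theorem tiltElem_dvd_of_coeff_zero {x : PreTilt O p} (hx : PreTilt.coeff 0 x = 0) :
    tiltElem w hw ∣ x := by
  have hp : p.Prime := Fact.out
  have := hv.hom_inj.isDomain
  have hwp : ∀ n, Associated (w n ^ p ^ n) (p : O) := fun n => by rwa [root_pow_eq w hw]
  have hwn0 : ∀ n, w n ≠ 0 := fun n h => hp0 (by
    have := hwp n
    rwa [h, zero_pow (pow_ne_zero n hp.ne_zero), Associated.comm, associated_zero_iff_eq_zero]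
      at this)
  have ha : ∀ n, ∃ b, Ideal.Quotient.mk _ (w n * b) = PreTilt.coeff n x := by
    intro n
    obtain ⟨a, ha⟩ := Ideal.Quotient.mk_surjective (PreTilt.coeff n x)
    have h1 : (p : O) ∣ a ^ p ^ n := by
      rw [← ModP_mk_eq_zero, map_pow, ha, PreTilt_coeff_pow_pow, hx]
    obtain ⟨b, rfl⟩ := Integers_dvd_of_pow_dvd_pow hv (pow_ne_zero n hp.ne_zero)
      ((hwp n).dvd.trans h1)
    exact ⟨b, ha⟩
  choose b hb using ha
  -- The quotients b n are determined only modulo p / w n, so they need not be compatible. The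
  -- defect d of b (n + 1) is divisible by w (n + 1) ^ (p ^ (n + 1) - 1), so d ^ p is divisible by
  -- p: the shifted p-th powers are compatible.
  have hcompat : ∀ n, (Ideal.Quotient.mk _ (b (n + 2)) ^ p) ^ p =
      (Ideal.Quotient.mk _ (b (n + 1)) ^ p : ModP O p) := by
    intro n
    rw [← sub_eq_zero, ← sub_pow_char, ← map_pow, ← map_sub, ← map_pow, ModP_mk_eq_zero]
    set d := b (n + 2) ^ p - b (n + 1)
    have h1 : (p : O) ∣ w (n + 1) * d := by
      rw [← ModP_mk_eq_zero]
      have : w (n + 1) * d = (w (n + 2) * b (n + 2)) ^ p - w (n + 1) * b (n + 1) := by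
        rw [mul_pow, hw]; ring
      rw [this, map_sub, map_pow, hb, hb, PreTilt.coeff_pow_p, sub_self]
    have hN : p ^ (n + 1) = p ^ (n + 1) - 1 + 1 := by
      have := pow_pos hp.pos (n + 1); omega
    have h2 : w (n + 1) ^ (p ^ (n + 1) - 1) ∣ d := by
      have := (hwp (n + 1)).dvd.trans h1
      rw [hN, pow_succ'] at this
      exact (mul_dvd_mul_iff_left (hwn0 (n + 1))).mp this
    have h5 := pow_dvd_pow_of_dvd h2 p
    rw [← pow_mul] at h5
    refine (hwp (n + 1)).symm.dvd.trans ((pow_dvd_pow _ ?_).trans h5)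
    have h3 : 2 ≤ p ^ (n + 1) := hp.two_le.trans (Nat.le_self_pow (by omega) p)
    have h4 : (p ^ (n + 1) - 1) * 2 ≤ (p ^ (n + 1) - 1) * p := Nat.mul_le_mul_left _ hp.two_le
    omega
  let z : PreTilt O p := ⟨fun n => Ideal.Quotient.mk _ (b (n + 1)) ^ p, hcompat⟩
  have hz : ∀ n, PreTilt.coeff n z = Ideal.Quotient.mk _ (b (n + 1)) ^ p := fun _ => rfl
  refine ⟨z, PreTilt_ext fun n => ?_⟩
  rw [map_mul, coeff_tiltElem, hz, ← hw, map_pow, ← mul_pow, ← map_mul, hb, PreTilt.coeff_pow_p]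

/-- Almost divisibility by the root of `p` in the tilt implies divisibility. -/
theorem tiltElem_dvd_of_almost {y : PreTilt O p}
    (h : ∀ n, tiltElem w hw ^ p ^ n ∣ tiltElem w hw * y ^ p ^ n) : tiltElem w hw ∣ y := by
  refine tiltElem_dvd_of_coeff_zero hv hw hw0 hp0 ?_
  have hp : p.Prime := Fact.out
  obtain ⟨a, ha⟩ := Ideal.Quotient.mk_surjective (PreTilt.coeff 0 y)
  -- In the n-th component the left side of the hypothesis becomes the 0-th component of the root
  -- system, which is zero. What remains is p ∣ w n * a; as |w n| tends to 1, this forces |a| ≤ |p|.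
  have hdvd : ∀ n, (p : O) ∣ w n * a := by
    intro n
    obtain ⟨c, hc⟩ := h n
    have := congrArg (PreTilt.coeff n) hc
    rw [map_mul, map_mul, map_pow, map_pow, PreTilt_coeff_pow_pow, PreTilt_coeff_pow_pow, ← ha,
      coeff_tiltElem, coeff_tiltElem, ModP_mk_eq_zero.mpr hw0.symm.dvd, zero_mul, ← map_mul,
      ModP_mk_eq_zero] at this
    exact this
  rw [← ha, ModP_mk_eq_zero, ← hv.le_iff_dvd]
  by_contra! hlt
  set P := v (algebraMap O L p)
  have hP : 0 < P := zero_lt_iff.mpr (by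
    rw [v.ne_zero_iff]
    exact fun h0 => hp0 (hv.hom_inj (by rw [h0, map_zero])))
  set A := v (algebraMap O L a)
  have hA : 0 < A := hP.trans hlt
  have hwP : ∀ n, v (algebraMap O L (w n)) ≤ P / A := by
    intro n
    rw [le_div_iff₀ hA, ← map_mul, ← map_mul, hv.le_iff_dvd]
    exact hdvd n
  have hr : P / A < 1 := (div_lt_one hA).mpr hlt
  obtain ⟨n, hn⟩ := exists_pow_lt_of_lt_one hP hr
  have h1 : P ≤ (P / A) ^ p ^ n := by
    calc P ≤ v (algebraMap O L (w n)) ^ p ^ n := by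
          rw [← map_pow, ← map_pow, root_pow_eq w hw, hv.le_iff_dvd]
          exact hw0.dvd
      _ ≤ _ := pow_le_pow_left₀ zero_le (hwP n) _
  have h2 : (P / A) ^ p ^ n ≤ (P / A) ^ n :=
    pow_le_pow_of_le_one zero_le hr.le (Nat.lt_pow_self hp.one_lt).le
  exact absurd (h1.trans h2) (not_le.mpr hn)

end Tilt
-- Successive approximation.
section Complete

/-- In a `q`-adically complete ring, successive approximation modulo `q` by multiples of `f`
converges to a multiple of `f`. -/
theorem dvd_of_forall_exists_eq_mul_add {A : Type*} [CommRing A] (q f : A)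
    [IsAdicComplete (Ideal.span {q}) A] (Q : A → Prop)
    (h : ∀ x, Q x → ∃ y x', x = f * y + q * x' ∧ Q x') {x : A} (hx : Q x) : f ∣ x := by
  choose! y s hys hs using h
  have hQ : ∀ n, Q (s^[n] x) := fun n => by
    induction n with
    | zero => exact hx
    | succ n ih => rw [Function.iterate_succ_apply']; exact hs _ ih
  have hsum : ∀ n, x = f * ∑ i ∈ Finset.range n, q ^ i * y (s^[i] x) + q ^ n * s^[n] x := by
    intro n
    induction n with
    | zero => simp
    | succ n ih =>
      rw [Finset.sum_range_succ, Function.iterate_succ_apply', pow_succ, mul_add]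
      have := hys _ (hQ n)
      calc x = f * ∑ i ∈ Finset.range n, q ^ i * y (s^[i] x) + q ^ n * s^[n] x := ih
        _ = f * ∑ i ∈ Finset.range n, q ^ i * y (s^[i] x)
            + q ^ n * (f * y (s^[n] x) + q * s (s^[n] x)) := by rw [← this]
        _ = _ := by ring
  obtain ⟨L, hL⟩ := IsPrecomplete.prec' (I := Ideal.span {q})
    (fun n => ∑ i ∈ Finset.range n, q ^ i * y (s^[i] x)) (by
      intro m n hmn
      rw [SModEq.sub_mem, smul_eq_mul, Ideal.mul_top, Ideal.span_singleton_pow,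
        Ideal.mem_span_singleton, ← dvd_neg, neg_sub, Finset.sum_range_sub_sum_range hmn]
      refine Finset.dvd_sum fun i hi => Dvd.dvd.mul_right (pow_dvd_pow q ?_) _
      simp at hi; omega)
  refine ⟨L, ?_⟩
  rw [← sub_eq_zero]
  refine IsHausdorff.haus (I := Ideal.span {q}) inferInstance _ fun n => ?_
  have := hL n
  rw [SModEq.sub_mem, smul_eq_mul, Ideal.mul_top, Ideal.span_singleton_pow,
    Ideal.mem_span_singleton] at this ⊢
  have h2 : x - f * L - 0 = f * (∑ i ∈ Finset.range n, q ^ i * y (s^[i] x) - L)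
      + q ^ n * s^[n] x := by
    nth_rw 1 [hsum n]; ring
  rw [h2]
  exact dvd_add (Dvd.dvd.mul_left this f) (dvd_mul_right _ _)

end Complete

/-! ### Periods in Witt vectors and the ideal generated by φ(t)^r. -/

section Witt

variable {p : ℕ} [hp : Fact p.Prime] {R : Type*} [CommRing R] [CharP R p] [PerfectRing R p]

local notation "φ" => (WittVector.frobenius : WittVector p R →+* WittVector p R)

theorem p_dvd_iff (x : WittVector p R) : (p : WittVector p R) ∣ x ↔ x.coeff 0 = 0 := by
  rw [← Ideal.mem_span_singleton, WittVector.mem_span_p_iff_coeff_zero_eq_zero]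

omit [CharP R p] [PerfectRing R p] in
theorem coeff_zero_mul (x y : WittVector p R) : (x * y).coeff 0 = x.coeff 0 * y.coeff 0 :=
  map_mul WittVector.constantCoeff x y

omit [CharP R p] [PerfectRing R p] in
theorem coeff_zero_add (x y : WittVector p R) : (x + y).coeff 0 = x.coeff 0 + y.coeff 0 :=
  map_add WittVector.constantCoeff x y

omit [CharP R p] [PerfectRing R p] in
theorem coeff_zero_sub (x y : WittVector p R) : (x - y).coeff 0 = x.coeff 0 - y.coeff 0 :=
  map_sub WittVector.constantCoeff x y

omit [PerfectRing R p] in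
theorem coeff_zero_p_mul (x : WittVector p R) : ((p : WittVector p R) * x).coeff 0 = 0 := by
  rw [mul_comm, WittVector.mul_charP_coeff_zero]

omit [PerfectRing R p] in
theorem coeff_zero_frobenius_iterate (x : WittVector p R) (n : ℕ) :
    (φ^[n] x).coeff 0 = x.coeff 0 ^ p ^ n :=
  WittVector.iterate_frobenius_coeff x n 0

omit [CharP R p] [PerfectRing R p] in
theorem frobenius_iterate_p_mul (x : WittVector p R) (n : ℕ) :
    φ^[n] (p * x) = p * φ^[n] x := by
  rw [← RingHom.coe_pow, map_mul, map_natCast]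

theorem isUnit_of_isUnit_coeff_zero {x : WittVector p R} (hx : IsUnit (x.coeff 0)) : IsUnit x := by
  obtain ⟨y, hy⟩ := hx.exists_right_inv
  have h1 : (p : WittVector p R) ∣ x * WittVector.teichmuller p y - 1 := by
    rw [p_dvd_iff, coeff_zero_sub, coeff_zero_mul, WittVector.teichmuller_coeff_zero, hy,
      WittVector.one_coeff_zero, sub_self]
  have h2 := IsAdicComplete.le_jacobson_bot (Ideal.span {(p : WittVector p R)})
    (Ideal.mem_span_singleton.mpr h1)
  have h3 := (Ideal.mem_jacobson_bot.mp h2) 1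
  rw [mul_one, sub_add_cancel] at h3
  exact isUnit_of_mul_isUnit_left h3

omit [CharP R p] [PerfectRing R p] in
theorem isUnit_coeff_zero {x : WittVector p R} (hx : IsUnit x) : IsUnit (x.coeff 0) :=
  hx.map (WittVector.constantCoeff : WittVector p R →+* R)

theorem exists_eq_teichmuller_add (x : WittVector p R) :
    ∃ y, x = WittVector.teichmuller p (x.coeff 0) + p * y := by
  have : (p : WittVector p R) ∣ x - WittVector.teichmuller p (x.coeff 0) := by
    rw [p_dvd_iff, coeff_zero_sub, WittVector.teichmuller_coeff_zero, sub_self]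
  obtain ⟨y, hy⟩ := this
  exact ⟨y, by rw [← hy]; ring⟩

/-- Multiplication by `d` is injective modulo `ξ`. -/
def IsRegularMod {A : Type*} [CommRing A] (ξ d : A) : Prop := ∀ y, ξ ∣ d * y → ξ ∣ y

section IsRegularMod

variable {A : Type*} [CommRing A] {ξ d d' : A}

theorem IsRegularMod.mul (h : IsRegularMod ξ d) (h' : IsRegularMod ξ d') :
    IsRegularMod ξ (d * d') := fun y hy => h' _ (h _ (by rwa [← mul_assoc]))

theorem IsRegularMod.pow (h : IsRegularMod ξ d) (k : ℕ) : IsRegularMod ξ (d ^ k) := by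
  induction k with
  | zero => intro y hy; simpa using hy
  | succ k ih => rw [pow_succ]; exact ih.mul h

theorem IsRegularMod.of_isUnit (h : IsUnit d) : IsRegularMod ξ d := fun _ hy =>
  (h.dvd_mul_left).mp hy

/-- In a domain one factor ξ at a time can be extracted from y and cancelled. -/
theorem IsRegularMod.pow_dvd [IsDomain A] (hξ : ξ ≠ 0) (h : IsRegularMod ξ d) (r : ℕ) {y : A}
    (hy : ξ ^ r ∣ d * y) : ξ ^ r ∣ y := by
  induction r generalizing y with
  | zero => simp
  | succ r ih =>
    obtain ⟨z, rfl⟩ := h y ((dvd_pow_self ξ (Nat.succ_ne_zero r)).trans hy)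
    rw [pow_succ'] at hy ⊢
    rw [mul_left_comm] at hy
    exact mul_dvd_mul_left ξ (ih ((mul_dvd_mul_iff_left hξ).mp hy))

/-- Modulo ξ some multiple of d equals q times a unit, so regularity passes from q to d. Applied
with q = p, this gives the regularity of both φ^(i+1)(ξ) and t. -/
theorem IsRegularMod.of_eq (q : A) (hq : IsRegularMod ξ q) {u a s : A} (hu : IsUnit u)
    (h : d * a = q * u + ξ * s) : IsRegularMod ξ d := by
  intro y hy
  have : ξ ∣ (q * u) * y := by
    have h1 : q * u * y = a * (d * y) - ξ * (s * y) := by linear_combination (-y) * h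
    rw [h1]
    exact dvd_sub (Dvd.dvd.mul_left hy a) (dvd_mul_right _ _)
  exact (hq.mul (.of_isUnit hu)) y this

end IsRegularMod

/-- A distinguished element `ξ = [ω] + p η` of `W(R)` and a solution `t`, nonzero modulo `p`, of
`φ(t) = c ξ t`, over a ring `R` in which almost divisibility by `ω` implies divisibility. -/
structure IsPeriod (ω : R) (ξ η c t : WittVector p R) : Prop where
  ne_zero : ω ≠ 0
  mem_jacobson : ω ∈ (⊥ : Ideal R).jacobson
  dvd_of_almost : ∀ y, (∀ n, ω ^ p ^ n ∣ ω * y ^ p ^ n) → ω ∣ y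
  eq_add : ξ = WittVector.teichmuller p ω + p * η
  isUnit_η : IsUnit η
  isUnit_c : IsUnit c
  frobenius_eq : φ t = c * ξ * t
  not_dvd : ¬ (p : WittVector p R) ∣ t

namespace IsPeriod

variable [IsDomain R] {ω : R} {ξ η c t : WittVector p R} (H : IsPeriod ω ξ η c t)
include H

omit [IsDomain R] [PerfectRing R p] in
theorem coeff_zero : ξ.coeff 0 = ω := by
  rw [H.eq_add, coeff_zero_add, coeff_zero_p_mul, WittVector.teichmuller_coeff_zero, add_zero]

omit [IsDomain R] [PerfectRing R p] in
theorem ξ_ne_zero : ξ ≠ 0 := fun h => H.ne_zero (by rw [← H.coeff_zero, h, WittVector.zero_coeff])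

omit [IsDomain R] [CharP R p] [PerfectRing R p] in
theorem t_ne_zero : t ≠ 0 := fun h => H.not_dvd (h ▸ dvd_zero _)

theorem p_dvd_of_dvd_mul {y : WittVector p R} (h : (p : WittVector p R) ∣ ξ * y) : (p : WittVector p R) ∣ y := by
  rw [p_dvd_iff] at h ⊢
  rw [coeff_zero_mul, H.coeff_zero] at h
  exact (mul_eq_zero.mp h).resolve_left H.ne_zero

theorem p_pow_dvd_of_dvd_mul {m k : ℕ} {y : WittVector p R} (h : (p : WittVector p R) ^ k ∣ ξ ^ m * y) :
    (p : WittVector p R) ^ k ∣ y := by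
  have hp0 : (p : WittVector p R) ≠ 0 := WittVector.p_nonzero p R
  have h1 : IsRegularMod (p : WittVector p R) ξ := fun y => H.p_dvd_of_dvd_mul
  exact (h1.pow m).pow_dvd hp0 k h

theorem isRegularMod_p : IsRegularMod ξ (p : WittVector p R) := by
  rintro y ⟨z, hz⟩
  obtain ⟨z', rfl⟩ := H.p_dvd_of_dvd_mul (Dvd.intro _ hz)
  refine ⟨z', mul_left_cancel₀ (WittVector.p_nonzero p R) ?_⟩
  rw [hz]; ring

/-- Modulo ξ one has [ω] ≡ -pη, which turns φ^(i+1)(ξ) = [ω]^(p^(i+1)) + p φ^(i+1)(η) into p times a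
unit. -/
theorem isRegularMod_frobenius (i : ℕ) : IsRegularMod ξ (φ^[i + 1] ξ) := by
  -- An exponent of at least 2 makes (-pη)^(p^(i+1)) divisible by p², so it does not disturb the
  -- unit φ^(i+1)(η) modulo p.
  obtain ⟨k, hk⟩ : ∃ k, p ^ (i + 1) = k + 2 :=
    Nat.exists_eq_add_of_le' (hp.1.two_le.trans (Nat.le_self_pow (Nat.succ_ne_zero i) p))
  have h1 : φ^[i + 1] ξ = WittVector.teichmuller p ω ^ p ^ (i + 1) + p * φ^[i + 1] η := by
    have h2 : φ^[i + 1] (WittVector.teichmuller p ω) = WittVector.teichmuller p ω ^ p ^ (i + 1) := by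
      rw [← map_pow]
      ext n
      rw [WittVector.iterate_frobenius_coeff]
      rcases n with _ | n
      · rw [WittVector.teichmuller_coeff_zero, WittVector.teichmuller_coeff_zero]
      · rw [WittVector.teichmuller_coeff_pos _ _ _ n.succ_pos,
          WittVector.teichmuller_coeff_pos _ _ _ n.succ_pos,
          zero_pow (pow_ne_zero _ hp.1.ne_zero)]
    conv_lhs => rw [H.eq_add]
    rw [iterate_map_add, frobenius_iterate_p_mul, h2]
  obtain ⟨s, hs⟩ : ξ ∣ WittVector.teichmuller p ω ^ p ^ (i + 1) - (-(p * η)) ^ p ^ (i + 1) := by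
    have := sub_dvd_pow_sub_pow (WittVector.teichmuller p ω) (-(p * η)) (p ^ (i + 1))
    rwa [sub_neg_eq_add, ← H.eq_add] at this
  have hu : IsUnit (φ^[i + 1] η + p * ((-η) ^ (k + 2) * p ^ k)) := by
    refine isUnit_of_isUnit_coeff_zero ?_
    rw [coeff_zero_add, coeff_zero_p_mul, add_zero, coeff_zero_frobenius_iterate]
    exact (isUnit_coeff_zero H.isUnit_η).pow _
  refine .of_eq (a := 1) (s := s) _ H.isRegularMod_p hu ?_
  rw [h1, ← hs, hk]
  ring

theorem coeff_zero_pow_pred :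
    t.coeff 0 ^ (p - 1) = c.coeff 0 * ω := by
  have h := congrArg (fun x => WittVector.coeff x 0) H.frobenius_eq
  simp only [coeff_zero_mul, H.coeff_zero, WittVector.coeff_frobenius_charP] at h
  have h0 : t.coeff 0 ≠ 0 := fun h => H.not_dvd ((p_dvd_iff t).mpr h)
  refine mul_right_cancel₀ h0 ?_
  rw [← pow_succ, Nat.sub_add_cancel hp.1.pos, h]

/-- For `p > 2`, the ideal `(ξ, t)` contains `p`. -/
theorem exists_p_mul_eq (hp2 : 2 < p) : ∃ u q : WittVector p R, IsUnit u ∧ ξ = t * q + p * u := by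
  obtain ⟨d, hd⟩ := (isUnit_coeff_zero H.isUnit_c).exists_left_inv
  obtain ⟨t', ht'⟩ := exists_eq_teichmuller_add t
  set a := d * t.coeff 0 ^ (p - 2)
  have hω : ω = a * t.coeff 0 := by
    have h1 := H.coeff_zero_pow_pred
    rw [show p - 1 = p - 2 + 1 by omega, pow_succ] at h1
    rw [mul_assoc, h1, ← mul_assoc, hd, one_mul]
  have hτ : t.coeff 0 ∈ (⊥ : Ideal R).jacobson := by
    refine Ideal.isRadical_jacobson (I := (⊥ : Ideal R)) ⟨p - 1, ?_⟩
    rw [H.coeff_zero_pow_pred]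
    exact Ideal.mul_mem_left _ _ H.mem_jacobson
  -- Since p > 2 the exponent p - 2 is positive; hence a lies in the Jacobson radical and η - [a] t'
  -- remains a unit.
  have ha : a ∈ (⊥ : Ideal R).jacobson :=
    Ideal.mul_mem_left _ _ (Ideal.pow_mem_of_mem _ hτ _ (by omega))
  refine ⟨η - WittVector.teichmuller p a * t', WittVector.teichmuller p a, ?_, ?_⟩
  · refine isUnit_of_isUnit_coeff_zero ?_
    rw [coeff_zero_sub, coeff_zero_mul, WittVector.teichmuller_coeff_zero]
    obtain ⟨e, he⟩ := isUnit_coeff_zero H.isUnit_η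
    have := Ideal.mem_jacobson_bot.mp ha (-(((e⁻¹ : Rˣ) : R) * t'.coeff 0))
    rw [← Units.isUnit_units_mul e] at this
    convert this using 1
    rw [← he]
    linear_combination (a * t'.coeff 0) * e.mul_inv
  · rw [H.eq_add]
    have h1 : WittVector.teichmuller p ω =
        WittVector.teichmuller p a * WittVector.teichmuller p (t.coeff 0) := by
      rw [← map_mul, ← hω]
    rw [h1]
    linear_combination (-WittVector.teichmuller p a) * ht'

theorem isRegularMod_t (hp2 : 2 < p) : IsRegularMod ξ t := by
  obtain ⟨u, q, hu, h⟩ := H.exists_p_mul_eq hp2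
  exact .of_eq (a := -q) (s := -1) _ H.isRegularMod_p hu (by linear_combination h)

/-- The cofactor d is a unit times a product of φ^i(ξ) with i ≥ 1, all regular modulo ξ. Exactly one
factor ξ is thus visible in φ^(n+1)(t), apart from t itself. -/
theorem frobenius_iterate_t (n : ℕ) : ∃ d, IsRegularMod ξ d ∧ φ^[n + 1] t = ξ * t * d := by
  induction n with
  | zero => exact ⟨c, .of_isUnit H.isUnit_c, by
      rw [Function.iterate_succ_apply, Function.iterate_zero_apply, H.frobenius_eq]; ring⟩
  | succ n ih =>
    obtain ⟨d, hd, h⟩ := ih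
    have hc : IsUnit (φ^[n + 1] c) := by
      rw [← RingHom.coe_pow]; exact H.isUnit_c.map _
    refine ⟨d * (φ^[n + 1] c * φ^[n + 1] ξ),
      hd.mul ((IsRegularMod.of_isUnit hc).mul (H.isRegularMod_frobenius n)), ?_⟩
    rw [Function.iterate_succ_apply, H.frobenius_eq, iterate_map_mul, iterate_map_mul, h]
    ring

/-- Apply φ to the relation at level n and write φ^(n+2)(t) = ξ t d. Cancelling ξ t leaves ξ ∣ d
φ(z), so ξ ∣ φ(z) by regularity of d; cancelling this ξ gives the relation at level n + 1. -/
theorem frobenius_iterate_dvd {x : WittVector p R} (hx : ∀ n, ξ ∣ φ^[n] x) (n : ℕ) :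
    φ^[n + 1] t ∣ t * φ^[n] x := by
  induction n with
  | zero =>
    rw [Function.iterate_succ_apply, Function.iterate_zero_apply, H.frobenius_eq, mul_assoc,
      H.isUnit_c.mul_left_dvd, mul_comm]
    exact mul_dvd_mul_left _ (hx 0)
  | succ n ih =>
    obtain ⟨z, hz⟩ := ih
    obtain ⟨x', hx'⟩ := hx (n + 1)
    obtain ⟨d, hd, hdt⟩ := H.frobenius_iterate_t (n + 1)
    have h1 : (c * ξ * t) * φ^[n + 1] x = φ^[n + 1 + 1] t * φ z := by
      have := congrArg φ hz
      rwa [map_mul, map_mul, ← Function.iterate_succ_apply' φ, ← Function.iterate_succ_apply' φ,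
        H.frobenius_eq] at this
    have hξt : ξ * t ≠ 0 := mul_ne_zero H.ξ_ne_zero H.t_ne_zero
    have h2 : d * φ z = ξ * (c * x') := by
      apply mul_left_cancel₀ hξt
      rw [hdt, hx'] at h1
      linear_combination -h1
    obtain ⟨z', hz'⟩ := hd _ (Dvd.intro _ h2.symm)
    have h3 : c * (t * φ^[n + 1] x) = φ^[n + 1 + 1] t * z' := by
      apply mul_left_cancel₀ H.ξ_ne_zero
      rw [hz'] at h1
      linear_combination h1
    rw [← H.isUnit_c.dvd_mul_left, h3]
    exact dvd_mul_right _ _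

/-- Modulo p, `frobenius_iterate_dvd` says that τ almost divides x' = (x/ξ) mod p. Almost
divisibility is then upgraded to divisibility, and x mod p = ω x' with ω ~ τ^(p-1). -/
theorem coeff_zero_dvd (hp2 : 2 < p) {x : WittVector p R} (hx : ∀ n, ξ ∣ φ^[n] x) :
    t.coeff 0 ^ p ∣ x.coeff 0 := by
  set τ := t.coeff 0 with hτdef
  have hτ0 : τ ≠ 0 := fun h => H.not_dvd ((p_dvd_iff t).mpr h)
  have hcu := isUnit_coeff_zero H.isUnit_c
  have hpred := H.coeff_zero_pow_pred
  have hassoc : Associated (τ ^ (p - 1)) ω := by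
    rw [hpred, mul_comm]
    exact associated_mul_unit_left _ _ hcu
  obtain ⟨y, hy⟩ := hx 0
  have hx0 : x.coeff 0 = ω * y.coeff 0 := by
    rw [← H.coeff_zero, ← coeff_zero_mul, ← hy]; rfl
  set x' := y.coeff 0
  have h1 : ∀ n, τ ^ p ^ n ∣ τ * x' ^ p ^ n := by
    intro n
    obtain ⟨z, hz⟩ := H.frobenius_iterate_dvd hx n
    have h2 := congrArg (fun x => WittVector.coeff x 0) hz
    simp only [coeff_zero_mul, coeff_zero_frobenius_iterate] at h2
    rw [← hτdef, hx0, mul_pow] at h2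
    have h3 : (τ ^ (p - 1)) ^ p ^ n * τ ^ p ^ n ∣ (τ ^ (p - 1)) ^ p ^ n * (τ * x' ^ p ^ n) := by
      have h4 : (τ ^ (p - 1)) ^ p ^ n * τ ^ p ^ n = τ ^ p ^ (n + 1) := by
        rw [← mul_pow, ← pow_succ, Nat.sub_add_cancel hp.1.pos, ← pow_mul, pow_succ']
      rw [h4]
      refine (Dvd.intro _ h2.symm).trans ?_
      rw [mul_left_comm]
      exact mul_dvd_mul_right (hassoc.symm.dvd |> fun h => pow_dvd_pow_of_dvd h _) _
    exact (mul_dvd_mul_iff_left (pow_ne_zero _ (pow_ne_zero _ hτ0))).mp h3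
  have hpsplit : τ ^ (p - 1) = τ * τ ^ (p - 2) := by
    rw [← pow_succ', show p - 2 + 1 = p - 1 by omega]
  -- `dvd_of_almost` concerns ω rather than τ; multiplying x' by τ^(p-2) turns almost divisibility
  -- by τ into almost divisibility by ω ~ τ^(p-1).
  have h5 : ω ∣ τ ^ (p - 2) * x' := by
    refine H.dvd_of_almost _ fun n => ?_
    refine (pow_dvd_pow_of_dvd hassoc.symm.dvd _).trans ?_
    rw [hpsplit, mul_pow, mul_pow, mul_left_comm, mul_comm]
    refine mul_dvd_mul_left _ ((h1 n).trans (mul_dvd_mul_right ?_ _))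
    exact (Dvd.intro _ hpsplit.symm).trans hassoc.dvd
  have h6 : τ ∣ x' := by
    have := hassoc.dvd.trans h5
    rw [hpsplit, mul_comm] at this
    exact (mul_dvd_mul_iff_left (pow_ne_zero _ hτ0)).mp this
  rw [hx0, show p = p - 1 + 1 by omega, pow_succ]
  exact mul_dvd_mul hassoc.dvd h6

theorem frobenius_t_dvd (hp2 : 2 < p) {x : WittVector p R} (hx : ∀ n, ξ ∣ φ^[n] x) : φ t ∣ x := by
  refine dvd_of_forall_exists_eq_mul_add (p : WittVector p R) (φ t) (fun x => ∀ n, ξ ∣ φ^[n] x) ?_ hx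
  intro x hx
  obtain ⟨s, hs⟩ := H.coeff_zero_dvd hp2 hx
  obtain ⟨x', hx'⟩ : (p : WittVector p R) ∣ x - φ t * WittVector.teichmuller p s := by
    rw [p_dvd_iff, coeff_zero_sub, coeff_zero_mul, WittVector.coeff_frobenius_charP,
      WittVector.teichmuller_coeff_zero, hs, sub_self]
  refine ⟨WittVector.teichmuller p s, x', by rw [← hx']; ring, fun n => H.isRegularMod_p _ ?_⟩
  obtain ⟨d, -, hd⟩ := H.frobenius_iterate_t n
  have h1 : (p : WittVector p R) * φ^[n] x' = φ^[n] (x - φ t * WittVector.teichmuller p s) := by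
    rw [hx', frobenius_iterate_p_mul]
  rw [h1, iterate_map_sub, iterate_map_mul, ← Function.iterate_succ_apply, hd]
  exact dvd_sub (hx n) (Dvd.intro _ (by rw [mul_assoc, mul_assoc]))

/-- `φ(t)^r` generates the ideal of all `x` with `φ^n(x) ∈ (ξ)^r` for all `n`. -/
theorem forall_pow_dvd_iff (hp2 : 2 < p) (r : ℕ) (x : WittVector p R) :
    (∀ n, ξ ^ r ∣ φ^[n] x) ↔ φ t ^ r ∣ x := by
  constructor
  · intro h
    induction r generalizing x with
    | zero => simp
    | succ r ih =>
      obtain ⟨y, rfl⟩ := H.frobenius_t_dvd hp2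
        fun n => (dvd_pow_self ξ (Nat.succ_ne_zero r)).trans (h n)
      rw [pow_succ']
      refine mul_dvd_mul_left _ (ih y fun n => ?_)
      obtain ⟨d, hd, hdt⟩ := H.frobenius_iterate_t n
      have h1 := h n
      rw [iterate_map_mul, ← Function.iterate_succ_apply φ, hdt, pow_succ', mul_assoc,
        mul_assoc, ← mul_assoc t, mul_dvd_mul_iff_left H.ξ_ne_zero] at h1
      exact ((H.isRegularMod_t hp2).mul hd).pow_dvd H.ξ_ne_zero r h1
  · rintro ⟨y, rfl⟩ n
    obtain ⟨d, -, hdt⟩ := H.frobenius_iterate_t n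
    rw [iterate_map_mul, iterate_map_pow, ← Function.iterate_succ_apply φ, hdt, mul_assoc, mul_pow,
      mul_assoc]
    exact dvd_mul_right _ _

end IsPeriod

end Witt
-- Divided powers.
section DivPow

variable {B : Type*} [CommRing B]

/-- The divided power `x^n / n!`, meaningful where `n!` is invertible. -/
noncomputable def divPow (n : ℕ) (x : B) : B := Ring.inverse (n.factorial : B) * x ^ n

variable (hB : ∀ n : ℕ, IsUnit (n.factorial : B))
include hB

theorem factorial_mul_divPow (n : ℕ) (x : B) : (n.factorial : B) * divPow n x = x ^ n := by
  rw [divPow, ← mul_assoc, Ring.mul_inverse_cancel _ (hB n), one_mul]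

theorem eq_divPow {n : ℕ} {x z : B} (h : (n.factorial : B) * z = x ^ n) : z = divPow n x :=
  (hB n).mul_left_cancel (by rw [h, factorial_mul_divPow hB])

omit hB in
theorem divPow_zero (x : B) : divPow 0 x = 1 := by simp [divPow]

omit hB in
theorem divPow_mul (n : ℕ) (x y : B) : divPow n (x * y) = x ^ n * divPow n y := by
  rw [divPow, divPow, mul_pow]; ring

theorem divPow_add (n : ℕ) (x y : B) :
    divPow n (x + y) = ∑ m ∈ Finset.HasAntidiagonal.antidiagonal n, divPow m.1 x * divPow m.2 y := by
  refine (eq_divPow hB ?_).symm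
  rw [(Commute.all x y).add_pow', Finset.mul_sum]
  refine Finset.sum_congr rfl fun m hm => ?_
  rw [Finset.HasAntidiagonal.mem_antidiagonal] at hm
  rw [← factorial_mul_divPow hB m.1 x, ← factorial_mul_divPow hB m.2 y, nsmul_eq_mul, ← hm,
    Nat.choose_symm_add, ← Nat.add_choose_mul_factorial_mul_factorial m.1 m.2]
  push_cast
  ring

theorem divPow_mul_divPow (m n : ℕ) (x : B) :
    divPow m x * divPow n x = ((m + n).choose n : B) * divPow (m + n) x := by
  apply ((hB m).mul (hB n)).mul_left_cancel
  have h1 := factorial_mul_divPow hB (m + n) x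
  rw [← Nat.add_choose_mul_factorial_mul_factorial m n] at h1
  push_cast at h1
  calc _ = (m.factorial * divPow m x) * (n.factorial * divPow n x) := by ring
    _ = x ^ (m + n) := by rw [factorial_mul_divPow hB, factorial_mul_divPow hB, pow_add]
    _ = _ := by rw [← h1]; ring

end DivPow

/-! ### The lattice of divided powers of ξ in W(R)[1/p]. -/

section Lattice

variable {p : ℕ} [hp : Fact p.Prime] {R : Type*} [CommRing R] [CharP R p] [PerfectRing R p]

local notation "φ" => (WittVector.frobenius : WittVector p R →+* WittVector p R)

theorem natCast_eq_p_pow_mul {n : ℕ} (hn : n ≠ 0) :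
    ∃ u : WittVector p R, IsUnit u ∧ (n : WittVector p R) = p ^ padicValNat p n * u := by
  obtain ⟨m, hm⟩ := pow_padicValNat_dvd (p := p) (n := n)
  refine ⟨(m : WittVector p R), ?_, by exact_mod_cast congrArg (Nat.cast (R := WittVector p R)) hm⟩
  have hcop : ¬ p ∣ m := by
    rintro ⟨k, rfl⟩
    refine pow_succ_padicValNat_not_dvd (p := p) hn ⟨k, ?_⟩
    rw [pow_succ, mul_assoc]; exact hm
  have hc : IsCoprime (m : ℤ) (p : ℤ) :=
    Nat.isCoprime_iff_coprime.mpr ((Nat.Prime.coprime_iff_not_dvd hp.1).mpr hcop).symm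
  obtain ⟨a, b, hab⟩ := hc
  refine isUnit_of_isUnit_coeff_zero ?_
  have h1 := congrArg (Int.cast (R := R)) hab
  push_cast at h1
  rw [CharP.cast_eq_zero R p, mul_zero, add_zero] at h1
  have h2 : (m : WittVector p R).coeff 0 = m :=
    map_natCast (WittVector.constantCoeff : WittVector p R →+* R) m
  rw [h2]
  exact IsUnit.of_mul_eq_one _ ((mul_comm _ _).trans h1)

theorem natCast_factorial_eq (n : ℕ) :
    ∃ u : WittVector p R, IsUnit u ∧
      (n.factorial : WittVector p R) = p ^ padicValNat p n.factorial * u :=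
  natCast_eq_p_pow_mul n.factorial_ne_zero

theorem factorial_dvd_p_pow {n k : ℕ} (h : padicValNat p n.factorial ≤ k) :
    (n.factorial : WittVector p R) ∣ p ^ k := by
  obtain ⟨u, hu, h1⟩ := natCast_factorial_eq (R := R) (p := p) n
  rw [h1, hu.mul_right_dvd]
  exact pow_dvd_pow _ h

theorem exists_le_padicValNat_factorial (p : ℕ) [Fact p.Prime] (k : ℕ) :
    ∃ n : ℕ, k ≤ padicValNat p n.factorial :=
  ⟨p * k, by rw [padicValNat_factorial_mul]; omega⟩

variable {B : Type*} [CommRing B] [Algebra (WittVector p R) B]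

variable (p R B) in
theorem isUnit_factorial_of_away [IsLocalization.Away (p : WittVector p R) B] (n : ℕ) :
    IsUnit (n.factorial : B) := by
  obtain ⟨u, hu, h1⟩ := natCast_factorial_eq (R := R) (p := p) n
  rw [← map_natCast (algebraMap (WittVector p R) B), h1, map_mul, map_pow]
  exact ((IsLocalization.Away.algebraMap_isUnit (p : WittVector p R)).pow _).mul (hu.map _)

local notation "ι" => algebraMap (WittVector p R) B

/-- The `W(R)`-submodule generated by the divided powers of `ξ`. -/
noncomputable def divPowSpan (B : Type*) [CommRing B] [Algebra (WittVector p R) B]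
    (ξ : WittVector p R) : Submodule (WittVector p R) B :=
  Submodule.span _ (Set.range fun n => divPow n (algebraMap (WittVector p R) B ξ))

omit [CharP R p] [PerfectRing R p] in
theorem divPow_mem_divPowSpan (ξ : WittVector p R) (n : ℕ) : divPow n (ι ξ) ∈ divPowSpan B ξ :=
  Submodule.subset_span ⟨n, rfl⟩

omit [CharP R p] [PerfectRing R p] in
theorem algebraMap_mem_divPowSpan (ξ w : WittVector p R) : ι w ∈ divPowSpan B ξ := by
  have := Submodule.smul_mem _ w (divPow_mem_divPowSpan (B := B) ξ 0)
  rwa [divPow_zero, ← Algebra.algebraMap_eq_smul_one] at this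

omit [CharP R p] [PerfectRing R p] in
theorem algebraMap_mul_mem_divPowSpan {ξ : WittVector p R} (w : WittVector p R) {y : B}
    (hy : y ∈ divPowSpan B ξ) : ι w * y ∈ divPowSpan B ξ := by
  rw [← Algebra.smul_def]; exact Submodule.smul_mem _ w hy

variable [IsLocalization.Away (p : WittVector p R) B]

theorem mul_mem_divPowSpan {ξ : WittVector p R} {x y : B} (hx : x ∈ divPowSpan B ξ)
    (hy : y ∈ divPowSpan B ξ) : x * y ∈ divPowSpan B ξ := by
  have : divPowSpan B ξ * divPowSpan B ξ ≤ divPowSpan B ξ := by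
    rw [divPowSpan, Submodule.span_mul_span, Submodule.span_le]
    rintro _ ⟨_, ⟨m, rfl⟩, _, ⟨n, rfl⟩, rfl⟩
    simp only
    rw [divPow_mul_divPow (isUnit_factorial_of_away p R B), ← map_natCast (algebraMap (WittVector p R) B)]
    exact algebraMap_mul_mem_divPowSpan _ (divPow_mem_divPowSpan ξ _)
  exact this (Submodule.mul_mem_mul hx hy)

theorem divPow_p_mem_range (n : ℕ) : ∃ w, divPow n (ι (p : WittVector p R)) = ι w := by
  obtain ⟨w, hw⟩ := factorial_dvd_p_pow (R := R) (padicValNat_factorial_le p n)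
  refine ⟨w, (eq_divPow (isUnit_factorial_of_away p R B) ?_).symm⟩
  rw [← map_pow, hw, map_mul, map_natCast]

/-- The divided powers of `φ(ξ) = ξ^p + p v` lie in the span of the divided powers of `ξ`. -/
theorem divPow_frobenius_mem (ξ : WittVector p R) (n : ℕ) :
    divPow n (ι (φ ξ)) ∈ divPowSpan B ξ := by
  obtain ⟨v, hv⟩ : (p : WittVector p R) ∣ φ ξ - ξ ^ p := by
    have h : (ξ ^ p).coeff 0 = ξ.coeff 0 ^ p :=
      map_pow (WittVector.constantCoeff : WittVector p R →+* R) ξ p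
    rw [p_dvd_iff, coeff_zero_sub, WittVector.coeff_frobenius_charP, h, sub_self]
  have h1 : φ ξ = ξ ^ (p - 1) * ξ + v * p := by
    rw [← pow_succ, Nat.sub_add_cancel hp.1.pos, mul_comm v, ← hv]; ring
  rw [h1, map_add, map_mul, map_mul, divPow_add (isUnit_factorial_of_away p R B)]
  refine Submodule.sum_mem _ fun m _ => ?_
  -- The divided powers of p are p-integral, so only those of ξ contribute denominators.
  obtain ⟨w, hw⟩ := divPow_p_mem_range (R := R) (p := p) (B := B) m.2
  rw [divPow_mul, divPow_mul, hw, ← map_pow, ← map_pow, ← map_mul, mul_comm]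
  exact algebraMap_mul_mem_divPowSpan _
    (algebraMap_mul_mem_divPowSpan _ (divPow_mem_divPowSpan ξ _))

/-- The extension of the Frobenius to `W(R)[1/p]`. -/
noncomputable def frobeniusAway (p : ℕ) [Fact p.Prime] (R : Type*) [CommRing R] (B : Type*)
    [CommRing B] [Algebra (WittVector p R) B] [IsLocalization.Away (p : WittVector p R) B] : B →+* B :=
  IsLocalization.Away.lift (p : WittVector p R) (g := (algebraMap (WittVector p R) B).comp WittVector.frobenius)
    (by
      rw [RingHom.comp_apply, map_natCast]
      exact IsLocalization.Away.algebraMap_isUnit _)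

omit [CharP R p] [PerfectRing R p] in
theorem frobeniusAway_algebraMap (w : WittVector p R) : frobeniusAway p R B (ι w) = ι (φ w) :=
  IsLocalization.Away.lift_eq _ _ w

omit [CharP R p] [PerfectRing R p] in
theorem frobeniusAway_iterate_algebraMap (w : WittVector p R) (n : ℕ) :
    (frobeniusAway p R B)^[n] (ι w) = ι (φ^[n] w) := by
  induction n with
  | zero => rfl
  | succ n ih => rw [Function.iterate_succ_apply', Function.iterate_succ_apply', ih,
      frobeniusAway_algebraMap]

theorem frobeniusAway_mem {ξ : WittVector p R} {y : B} (hy : y ∈ divPowSpan B ξ) :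
    frobeniusAway p R B y ∈ divPowSpan B ξ := by
  induction hy using Submodule.span_induction with
  | mem x h =>
    obtain ⟨n, rfl⟩ := h
    have : frobeniusAway p R B (divPow n (ι ξ)) = divPow n (ι (φ ξ)) := by
      refine eq_divPow (isUnit_factorial_of_away p R B) ?_
      rw [← frobeniusAway_algebraMap, ← map_pow, ← factorial_mul_divPow (isUnit_factorial_of_away p R B),
        map_mul, map_natCast]
    simp only [this]
    exact divPow_frobenius_mem ξ n
  | zero => rw [map_zero]; exact Submodule.zero_mem _
  | add x y _ _ hx hy => rw [map_add]; exact Submodule.add_mem _ hx hy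
  | smul w x _ hx =>
    rw [Algebra.smul_def, map_mul, frobeniusAway_algebraMap]
    exact algebraMap_mul_mem_divPowSpan _ hx

theorem frobeniusAway_iterate_mem {ξ : WittVector p R} {y : B} (hy : y ∈ divPowSpan B ξ) (n : ℕ) :
    (frobeniusAway p R B)^[n] y ∈ divPowSpan B ξ := by
  induction n with
  | zero => exact hy
  | succ n ih => rw [Function.iterate_succ_apply']; exact frobeniusAway_mem ih

omit [CharP R p] [PerfectRing R p] [IsLocalization.Away (p : WittVector p R) B] in
-- Divided powers of order at least m are multiples of ξ^m once p is inverted; only those of order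
-- below m keep W(R)-coefficients.
theorem exists_sum_add_of_mem {ξ : WittVector p R} {y : B} (hy : y ∈ divPowSpan B ξ) (m : ℕ) :
    ∃ (w : ℕ → WittVector p R) (z : B),
      y = ∑ j ∈ Finset.range m, ι (w j) * divPow j (ι ξ) + ι ξ ^ m * z := by
  induction hy using Submodule.span_induction with
  | mem x h =>
    obtain ⟨n, rfl⟩ := h
    by_cases hn : n < m
    · refine ⟨fun j => if j = n then 1 else 0, 0, ?_⟩
      rw [Finset.sum_eq_single_of_mem n (Finset.mem_range.mpr hn) fun j _ hj => by simp [hj]]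
      simp
    · refine ⟨0, Ring.inverse (n.factorial : B) * ι ξ ^ (n - m), ?_⟩
      have : ι ξ ^ n = ι ξ ^ m * ι ξ ^ (n - m) := by rw [← pow_add]; congr 1; omega
      simp only [divPow, this]
      simp; ring
  | zero => exact ⟨0, 0, by simp⟩
  | add x y _ _ hx hy =>
    obtain ⟨w, z, rfl⟩ := hx
    obtain ⟨w', z', rfl⟩ := hy
    refine ⟨w + w', z + z', ?_⟩
    simp only [Pi.add_apply, map_add, add_mul, Finset.sum_add_distrib]
    ring
  | smul u x _ hx =>
    obtain ⟨w, z, rfl⟩ := hx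
    refine ⟨fun j => u * w j, ι u * z, ?_⟩
    simp only [Algebra.smul_def, map_mul, mul_add, Finset.mul_sum, mul_assoc]
    ring

omit [CharP R p] [PerfectRing R p] [IsLocalization.Away (p : WittVector p R) B] in
theorem exists_algebraMap_add_of_mem {ξ : WittVector p R} {y : B} (hy : y ∈ divPowSpan B ξ) :
    ∃ (w : WittVector p R) (z : B), y = ι w + ι ξ * z := by
  obtain ⟨w, z, h⟩ := exists_sum_add_of_mem hy 1
  exact ⟨w 0, z, by simpa [divPow_zero] using h⟩

variable (B) in
-- Only factorials j! with j < m occur before the ξ^m tail, so one power of p clears their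
-- denominators uniformly in y.
theorem exists_p_pow_mul_of_mem (ξ : WittVector p R) (m : ℕ) :
    ∃ C : ℕ, ∀ y ∈ divPowSpan B ξ, ∃ (w : WittVector p R) (z : B),
      (p : B) ^ C * y = ι w + ι ξ ^ m * z := by
  refine ⟨m, fun y hy => ?_⟩
  obtain ⟨w, z, rfl⟩ := exists_sum_add_of_mem hy m
  have h : ∀ j ∈ Finset.range m, ∃ g : WittVector p R,
      (p : B) ^ m * (ι (w j) * divPow j (ι ξ)) = ι g := by
    intro j hj
    obtain ⟨g, hg⟩ := factorial_dvd_p_pow (R := R) ((padicValNat_factorial_le p j).trans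
      (Finset.mem_range.mp hj).le)
    refine ⟨g * w j * ξ ^ j, ?_⟩
    have h1 : (p : B) ^ m = j.factorial * ι g := by
      simpa using congrArg (algebraMap (WittVector p R) B) hg
    rw [h1, map_mul, map_mul, map_pow, ← factorial_mul_divPow (isUnit_factorial_of_away p R B) j (ι ξ)]
    ring
  choose! g hg using h
  refine ⟨∑ j ∈ Finset.range m, g j, p ^ m * z, ?_⟩
  rw [mul_add, Finset.mul_sum, Finset.sum_congr rfl hg, map_sum]
  ring

theorem isUnit_p_away (p : ℕ) [Fact p.Prime] (R : Type*) [CommRing R] (B : Type*) [CommRing B]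
    [Algebra (WittVector p R) B] [IsLocalization.Away (p : WittVector p R) B] : IsUnit (p : B) := by
  have := IsLocalization.Away.algebraMap_isUnit (S := B) (p : WittVector p R)
  rwa [map_natCast] at this

variable (p R B) in
omit [PerfectRing R p] in
theorem algebraMap_away_injective [IsDomain R] :
    Function.Injective (algebraMap (WittVector p R) B) :=
  IsLocalization.injective B (powers_le_nonZeroDivisors_of_noZeroDivisors
    (WittVector.p_nonzero p R))

theorem isDomain_away (p : ℕ) [Fact p.Prime] (R : Type*) [CommRing R] [CharP R p] [IsDomain R]
    (B : Type*) [CommRing B] [Algebra (WittVector p R) B]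
    [IsLocalization.Away (p : WittVector p R) B] : IsDomain B :=
  IsLocalization.isDomain_of_le_nonZeroDivisors _ (powers_le_nonZeroDivisors_of_noZeroDivisors
    (WittVector.p_nonzero p R))

namespace IsPeriod

variable [IsDomain R] {ω : R} {ξ η c t : WittVector p R} (H : IsPeriod ω ξ η c t)

include H

/-- Since ξ is regular modulo p, inverting p creates no new multiples of ξ^m in W(R). -/
theorem exists_of_algebraMap_eq_pow_mul {m : ℕ} {x : WittVector p R} {z : B}
    (h : ι x = ι ξ ^ m * z) : ∃ y, z = ι y ∧ x = ξ ^ m * y := by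
  obtain ⟨k, z', hz'⟩ := IsLocalization.Away.surj (p : WittVector p R) z
  have h1 : x * p ^ k = ξ ^ m * z' := by
    apply algebraMap_away_injective p R B
    rw [map_mul, h, map_mul, map_pow, map_pow, ← hz']; ring
  obtain ⟨y, rfl⟩ := H.p_pow_dvd_of_dvd_mul (Dvd.intro_left _ h1)
  refine ⟨y, ?_, ?_⟩
  · apply ((isUnit_p_away p R B).pow k).mul_right_cancel
    rw [map_natCast] at hz'
    rw [hz', map_mul, map_pow, map_natCast]; ring
  · apply mul_right_cancel₀ (pow_ne_zero k (WittVector.p_nonzero p R))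
    rw [h1]; ring

/-- The span of the divided powers of `ξ` is closed in `W(R)[1/p]` for the `ξ`-adic topology. -/
theorem mem_divPowSpan_of_forall {a : B}
    (ha : ∀ m, ∃ y ∈ divPowSpan B ξ, ∃ z, a = y + ι ξ ^ m * z) : a ∈ divPowSpan B ξ := by
  obtain ⟨K, b, hb⟩ := IsLocalization.Away.surj (p : WittVector p R) a
  rw [map_natCast] at hb
  -- Take m least with p^K ∣ m!. For j < m the factor p^K clears j!, so p^K z is integral; since p^K
  -- ∣ m!, the tail ξ^m z is an integral multiple of ξ^m/m!.
  have hex := exists_le_padicValNat_factorial p K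
  classical
  let m := Nat.find hex
  have hm : K ≤ padicValNat p m.factorial := Nat.find_spec hex
  have hlt : ∀ j < m, padicValNat p j.factorial ≤ K := fun j hj => by
    have := Nat.find_min hex hj; omega
  obtain ⟨y, hy, z₀, hz₀⟩ := ha m
  obtain ⟨w, z₁, hy'⟩ := exists_sum_add_of_mem hy m
  set z := z₁ + z₀
  have hz : a = ∑ j ∈ Finset.range m, ι (w j) * divPow j (ι ξ) + ι ξ ^ m * z := by
    rw [hz₀, hy']; ring
  have h : ∀ j ∈ Finset.range m, ∃ g : WittVector p R,
      (p : B) ^ K * (ι (w j) * divPow j (ι ξ)) = ι g := by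
    intro j hj
    obtain ⟨g, hg⟩ := factorial_dvd_p_pow (R := R) (hlt j (Finset.mem_range.mp hj))
    refine ⟨g * w j * ξ ^ j, ?_⟩
    have h1 : (p : B) ^ K = j.factorial * ι g := by
      simpa using congrArg (algebraMap (WittVector p R) B) hg
    rw [h1, map_mul, map_mul, map_pow, ← factorial_mul_divPow (isUnit_factorial_of_away p R B) j (ι ξ)]
    ring
  choose! g hg using h
  have h2 : ι (b - ∑ j ∈ Finset.range m, g j) = ι ξ ^ m * ((p : B) ^ K * z) := by
    rw [map_sub, map_sum, ← Finset.sum_congr rfl hg, ← hb, ← Finset.mul_sum]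
    linear_combination ((p : B) ^ K) * hz
  obtain ⟨z', hz', -⟩ := H.exists_of_algebraMap_eq_pow_mul h2
  obtain ⟨u, hu, hfact⟩ := natCast_factorial_eq (R := R) (p := p) m
  obtain ⟨e, he⟩ : ∃ e : WittVector p R, (m.factorial : WittVector p R) = p ^ K * e :=
    ⟨p ^ (padicValNat p m.factorial - K) * u, by
      rw [← mul_assoc, ← pow_add, Nat.add_sub_cancel' hm, hfact]⟩
  have he' : (m.factorial : B) = p ^ K * ι e := by
    simpa using congrArg (algebraMap (WittVector p R) B) he
  rw [hz]
  refine Submodule.add_mem _ (Submodule.sum_mem _ fun j _ =>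
    algebraMap_mul_mem_divPowSpan _ (divPow_mem_divPowSpan ξ j)) ?_
  have h3 : ι ξ ^ m * z = ι (e * z') * divPow m (ι ξ) := by
    rw [← factorial_mul_divPow (isUnit_factorial_of_away p R B) m (ι ξ), he', map_mul, ← hz']; ring
  rw [h3]
  exact algebraMap_mul_mem_divPowSpan _ (divPow_mem_divPowSpan ξ m)

theorem mem_p_pow_divPowSpan_of_forall (n : ℕ) {a : B}
    (ha : ∀ m, ∃ y ∈ divPowSpan B ξ, ∃ z, a = p ^ n * y + ι ξ ^ m * z) :
    ∃ y ∈ divPowSpan B ξ, a = p ^ n * y := by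
  obtain ⟨q, hq⟩ := ((isUnit_p_away p R B).pow n).exists_right_inv
  refine ⟨q * a, H.mem_divPowSpan_of_forall fun m => ?_, by rw [← mul_assoc, hq, one_mul]⟩
  obtain ⟨y, hy, z, rfl⟩ := ha m
  exact ⟨y, hy, q * z, by linear_combination y * hq⟩

/-- This is p-adic separatedness of W(R)/ξ: write x = ξ y + p w; regularity of p modulo ξ makes w
inherit the hypothesis, and the approximation continues. -/
theorem dvd_of_forall_exists_dvd_sub {x : WittVector p R}
    (hx : ∀ i : ℕ, ∃ w, ξ ∣ x - p ^ i * w) : ξ ∣ x := by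
  refine dvd_of_forall_exists_eq_mul_add (p : WittVector p R) ξ
    (fun x => ∀ i : ℕ, ∃ w, ξ ∣ x - p ^ i * w) ?_ hx
  intro x hx
  obtain ⟨w, y, hy⟩ := hx 1
  refine ⟨y, w, by rw [← hy]; ring, fun i => ?_⟩
  obtain ⟨w', hw'⟩ := hx (i + 1)
  refine ⟨w', H.isRegularMod_p _ ?_⟩
  have : p * (w - p ^ i * w') = (x - p ^ (i + 1) * w') - ξ * y := by
    rw [← hy]; ring
  rw [this]
  exact dvd_sub hw' (dvd_mul_right _ _)

/-- If `x ∈ W(R)` is the `p`-adic limit of multiples of `φ(t)` in the divided power envelope, then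
`φ^n(x) ∈ (ξ)` for all `n`. -/
theorem dvd_frobenius_iterate_of_approx {x : WittVector p R}
    (hx : ∀ i : ℕ, ∃ a : B, ∃ e ∈ divPowSpan B ξ, ι x = ι (φ t) * a + p ^ i * e) (n : ℕ) :
    ξ ∣ φ^[n] x := by
  refine H.dvd_of_forall_exists_dvd_sub fun i => ?_
  obtain ⟨a, e, he, h⟩ := hx i
  -- φ^n keeps the error in the lattice, where it is integral up to a multiple of ξ in W(R)[1/p];
  -- the main term acquires the factor ξ of φ^(n+1)(t).
  obtain ⟨w, z, hw⟩ := exists_algebraMap_add_of_mem (frobeniusAway_iterate_mem he n)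
  obtain ⟨d, -, hd⟩ := H.frobenius_iterate_t n
  have h1 := congrArg (frobeniusAway p R B)^[n] h
  have hpn : (frobeniusAway p R B)^[n] ((p : B) ^ i) = p ^ i := by
    rw [← RingHom.coe_pow, map_pow, map_natCast]
  rw [frobeniusAway_iterate_algebraMap, iterate_map_add, iterate_map_mul, iterate_map_mul,
    frobeniusAway_iterate_algebraMap, ← Function.iterate_succ_apply φ, hd, hpn, hw] at h1
  obtain ⟨y, -, hy⟩ := H.exists_of_algebraMap_eq_pow_mul (B := B) (m := 1)
    (x := φ^[n] x - p ^ i * w) (z := ι t * ι d * (frobeniusAway p R B)^[n] a + p ^ i * z) (by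
      rw [map_sub, h1, map_mul, map_mul, map_mul, map_pow, map_natCast]
      ring)
  exact ⟨w, y, by rw [hy, pow_one]⟩

/-- Multiplication by `φ(t)` is injective on the `p`-adic completion of the divided power
envelope. -/
theorem mem_of_frobenius_t_mul_mem (hp2 : 2 < p) (a : ℕ → B)
    (hcompat : ∀ i j, i ≤ j → ∃ e ∈ divPowSpan B ξ, a j - a i = p ^ i * e)
    (ha : ∀ i, ∃ e ∈ divPowSpan B ξ, ι (φ t) * a i = p ^ i * e) (n : ℕ) :
    ∃ e ∈ divPowSpan B ξ, a n = p ^ n * e := by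
  have := isDomain_away p R B
  refine H.mem_p_pow_divPowSpan_of_forall n fun m => ?_
  -- The precision n + m + C pays for two losses: p^C clears denominators, and p^m replaces t, which
  -- divides (pu)^m modulo ξ^m. The exponent m + 1 leaves ξ^m after cancelling the ξ in φ(t) = c ξ
  -- t.
  obtain ⟨C, hC⟩ := exists_p_pow_mul_of_mem B ξ (m + 1)
  obtain ⟨e, he, hae⟩ := ha (n + m + C)
  obtain ⟨w, z, hw⟩ := hC e he
  obtain ⟨e', he', hn⟩ := hcompat n (n + m + C) (by omega)
  obtain ⟨u, q, hu, hξ⟩ := H.exists_p_mul_eq hp2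
  obtain ⟨c', hc'⟩ := H.isUnit_c.exists_left_inv
  obtain ⟨u', hu'⟩ := (hu.pow m).exists_left_inv
  set b := a (n + m + C)
  obtain ⟨s, hs⟩ : t ∣ (p * u) ^ m - ξ ^ m := by
    refine Dvd.dvd.trans ?_ (sub_dvd_pow_sub_pow _ _ m)
    exact ⟨-q, by rw [hξ]; ring⟩
  have hs' : (p : B) ^ m * ι u ^ m - ι ξ ^ m = ι t * ι s := by
    have := congrArg (algebraMap (WittVector p R) B) hs
    simpa [mul_pow] using this
  have hcB : ι c' * ι c = 1 := by rw [← map_mul, hc', map_one]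
  have h1 : ι c * ι ξ * ι t * b = p ^ (n + m) * ι w + ι ξ ^ (m + 1) * (p ^ (n + m) * z) := by
    rw [← map_mul, ← map_mul, ← H.frobenius_eq, hae, pow_add _ (n + m) C, mul_assoc, hw]; ring
  obtain ⟨p', hp'⟩ := ((isUnit_p_away p R B).pow m).exists_left_inv
  obtain ⟨p'', hp''⟩ := ((isUnit_p_away p R B).pow n).exists_left_inv
  set z₁ := ι s * ι c' * p ^ n * z + p' * b
  have h2 : ι ξ * ι u ^ m * b = p ^ n * ι (s * c' * w) + ι ξ ^ (m + 1) * z₁ := by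
    have h3 : (p : B) ^ m * (ι ξ * ι u ^ m * b) =
        p ^ m * (p ^ n * ι (s * c' * w) + ι ξ ^ (m + 1) * z₁) := by
      have h4 : p ^ m * p' = (1 : B) := by rw [mul_comm]; exact hp'
      simp only [z₁, map_mul]
      rw [pow_add (p : B) n m] at h1
      linear_combination (ι ξ * b) * hs' + (ι s * ι c') * h1 - (ι ξ * ι t * ι s * b) * hcB
        - (ι ξ ^ (m + 1) * b) * h4
    exact ((isUnit_p_away p R B).pow m).mul_left_cancel h3
  obtain ⟨w', -, hw'⟩ := H.exists_of_algebraMap_eq_pow_mul (B := B) (m := 1) (x := s * c' * w)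
    (z := p'' * (ι u ^ m * b - ι ξ ^ m * z₁)) (by
      linear_combination -p'' * h2 - ι (s * c' * w) * hp'')
  have hξ0 : ι ξ ≠ 0 := by
    rw [Ne, ← map_zero ι]; exact (algebraMap_away_injective p R B).ne H.ξ_ne_zero
  have h5 : ι u ^ m * b = p ^ n * ι w' + ι ξ ^ m * z₁ := by
    apply mul_left_cancel₀ hξ0
    rw [hw', map_mul, map_pow] at h2
    linear_combination h2
  have huB : ι u' * ι u ^ m = 1 := by rw [← map_pow, ← map_mul, hu', map_one]
  refine ⟨ι (u' * w') - e', Submodule.sub_mem _ (algebraMap_mem_divPowSpan ξ _) he', ι u' * z₁, ?_⟩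
  rw [map_mul]
  linear_combination -hn - b * huB + ι u' * h5

end IsPeriod

end Lattice
-- Completion along a principal ideal.
section AdicCompletionSpan

variable {A : Type*} [CommRing A] (q : A)

/-- An element of the `q`-adic completion is represented by a `q`-adic Cauchy sequence. -/
theorem exists_adic_representatives (α : AdicCompletion (Ideal.span {q}) A) :
    ∃ a : ℕ → A, (∀ n, AdicCompletion.evalₐ (Ideal.span {q}) n α = Ideal.Quotient.mk _ (a n)) ∧
      ∀ i j, i ≤ j → q ^ i ∣ a j - a i := by
  obtain ⟨f, rfl⟩ := AdicCompletion.mk_surjective _ _ α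
  refine ⟨f, fun n => AdicCompletion.evalₐ_mk _ n f, fun i j hij => ?_⟩
  have := f.2 hij
  rw [SModEq.sub_mem, smul_eq_mul, Ideal.mul_top, Ideal.span_singleton_pow,
    Ideal.mem_span_singleton] at this
  rw [← dvd_neg, neg_sub]
  exact this

theorem mk_span_pow_eq_zero {a : A} {n : ℕ} :
    Ideal.Quotient.mk (Ideal.span {q} ^ n) a = 0 ↔ q ^ n ∣ a := by
  rw [Ideal.Quotient.eq_zero_iff_mem, Ideal.span_singleton_pow, Ideal.mem_span_singleton]

/-- Cancelling q loses one level of precision, so vanishing at level n is read off at level n + 1.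
-/
theorem adicCompletion_eq_zero_of_mul_eq_zero [IsDomain A] (hq : q ≠ 0)
    {α : AdicCompletion (Ideal.span {q}) A} (h : algebraMap A _ q * α = 0) : α = 0 := by
  obtain ⟨a, ha, hcomp⟩ := exists_adic_representatives q α
  refine AdicCompletion.ext_evalₐ fun n => ?_
  have h1 := congrArg (AdicCompletion.evalₐ (Ideal.span {q}) (n + 1)) h
  rw [map_mul, map_zero, ha, AlgHom.commutes, Ideal.Quotient.algebraMap_eq, ← map_mul,
    mk_span_pow_eq_zero, pow_succ', mul_dvd_mul_iff_left hq] at h1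
  rw [map_zero, ha, mk_span_pow_eq_zero]
  have := dvd_sub h1 (hcomp n (n + 1) n.le_succ)
  rwa [sub_sub_cancel] at this

end AdicCompletionSpan

/-! ### The kernel of θ. -/

section Theta

variable {O : Type v} [CommRing O] {p : ℕ} [hp : Fact p.Prime] [Fact (¬ IsUnit (p : O))]

theorem evalₐ_theta (n : ℕ) (x : WR O p) :
    AdicCompletion.evalₐ (Ideal.span {(p : O)}) n (theta O p x) =
      Ideal.Quotient.factorPow (Ideal.span {(p : O)}) (Nat.le_succ n) (thetaModPPow O p n x) :=
  AdicCompletion.evalₐ_liftRingHom _ _ _ n x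

theorem theta_eq_zero_of_forall {x : WR O p} (h : ∀ n, thetaModPPow O p n x = 0) :
    theta O p x = 0 := by
  refine AdicCompletion.ext_evalₐ fun n => ?_
  rw [evalₐ_theta, h, map_zero, map_zero]

/-- Modulo p, θ depends only on the 0-th Witt component, through the projection of the tilt to O/p.
-/
theorem coeff_zero_of_theta_eq_zero {x : WR O p} (h : theta O p x = 0) :
    PreTilt.coeff 0 (x.coeff 0) = 0 := by
  have h1 := evalₐ_theta 1 x
  rw [h, map_zero] at h1
  have h0 : thetaModPPow O p 0 x = 0 := by
    rw [← factorPow_comp_thetaModPPow O p (Nat.zero_le 1), RingHom.comp_apply]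
    exact h1.symm
  obtain ⟨y, hy⟩ := exists_eq_teichmuller_add x
  obtain ⟨a, ha⟩ := Ideal.Quotient.mk_surjective (PreTilt.coeff 0 (x.coeff 0))
  have h2 : thetaModPPow O p 0 (p * y) = 0 := by
    obtain ⟨b, hb⟩ := Ideal.Quotient.mk_surjective (thetaModPPow O p 0 y)
    have h3 : (p : O ⧸ Ideal.span {(p : O)} ^ (0 + 1)) = Ideal.Quotient.mk _ (p : O) :=
      (map_natCast _ p).symm
    rw [map_mul, map_natCast, h3, ← hb, ← map_mul, mk_span_pow_eq_zero, zero_add, pow_one]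
    exact dvd_mul_right _ _
  have h4 : thetaModPPow O p 0 (WittVector.teichmuller p (x.coeff 0)) = 0 := by
    have := congrArg (thetaModPPow O p 0) hy
    rw [map_add, h2, h0, add_zero] at this
    exact this.symm
  rw [thetaModPPow_teichmuller 0 _ a ha, mk_span_pow_eq_zero, zero_add, pow_one, pow_zero,
    pow_one] at h4
  rw [← ha, ModP_mk_eq_zero]
  exact h4

/-- If `θ(ξ) = 0` and the reduction of `ξ` modulo `p` divides every element of the tilt that
vanishes in `O / p`, then `ξ` generates the kernel of `θ`. -/
theorem ker_theta_eq_span [IsDomain O] (hp0 : (p : O) ≠ 0) {ξ : WR O p} (hξ : theta O p ξ = 0)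
    (hdvd : ∀ x : PreTilt O p, PreTilt.coeff 0 x = 0 → ξ.coeff 0 ∣ x) :
    RingHom.ker (theta O p) = Ideal.span {ξ} := by
  refine le_antisymm (fun x hx => ?_) ?_
  · rw [Ideal.mem_span_singleton]
    refine dvd_of_forall_exists_eq_mul_add (p : WR O p) ξ (fun x => theta O p x = 0) ?_ hx
    intro x hx
    obtain ⟨s, hs⟩ := hdvd _ (coeff_zero_of_theta_eq_zero hx)
    obtain ⟨x', hx'⟩ : (p : WR O p) ∣ x - ξ * WittVector.teichmuller p s := by
      rw [p_dvd_iff, coeff_zero_sub, coeff_zero_mul, WittVector.teichmuller_coeff_zero, hs, sub_self]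
    refine ⟨WittVector.teichmuller p s, x', by rw [← hx']; ring,
      adicCompletion_eq_zero_of_mul_eq_zero (p : O) hp0 ?_⟩
    rw [map_natCast, ← map_natCast (theta O p), ← map_mul, ← hx', map_sub, map_mul, hx, hξ, zero_mul,
      sub_zero]
  · rw [Ideal.span_singleton_le_iff_mem]
    exact hξ

variable {k : Type u} [Field k] [CharP k p] [PerfectRing k p] [Algebra (WittVector p k) O]

omit [Fact (¬ IsUnit (p : O))] in
theorem residueMap_apply (b : k) :
    residueMap p k O b =
      Ideal.Quotient.mk _ (algebraMap (WittVector p k) O (WittVector.teichmuller p b)) := by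
  have : (WittVector.quotientPEquiv (p := p) (k := k)).symm b =
      Ideal.Quotient.mk _ (WittVector.teichmuller p b) := by
    rw [RingEquiv.symm_apply_eq]
    exact (WittVector.teichmuller_coeff_zero (p := p) b).symm
  simp only [residueMap, RingHom.comp_apply, RingEquiv.toRingHom_eq_coe, RingHom.coe_coe, this,
    Ideal.Quotient.lift_mk]

theorem coeff_embk (n : ℕ) (a : k) :
    PreTilt.coeff n (embk p k O a) =
      residueMap p k O (((frobeniusEquiv k p).symm : k →+* k)^[n] a) := rfl

/-- As p is nilpotent in the target, it suffices to compare Teichmüller elements. There the p^n-th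
root taken by `embk` in component n is undone by the p^n-th power in θ. -/
theorem thetaModPPow_embWk (n : ℕ) (a : WittVector p k) :
    thetaModPPow O p n (embWk p k O a) = Ideal.Quotient.mk _ (algebraMap (WittVector p k) O a) := by
  have : (thetaModPPow O p n).comp (embWk p k O) =
      (Ideal.Quotient.mk _).comp (algebraMap (WittVector p k) O) := by
    apply WittVector.eq_of_apply_teichmuller_eq
    · refine ⟨n + 1, ?_⟩
      rw [← map_natCast (Ideal.Quotient.mk (Ideal.span {(p : O)} ^ (n + 1))), ← map_pow,
        mk_span_pow_eq_zero]
    · intro x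
      rw [RingHom.comp_apply, RingHom.comp_apply, embWk, WittVector.map_teichmuller,
        thetaModPPow_teichmuller n _ _ ((residueMap_apply _).symm.trans (coeff_embk n x).symm),
        ← map_pow, ← map_pow]
      congr 3
      have h : ∀ m (y : k), ((frobeniusEquiv k p).symm : k →+* k)^[m] y ^ p ^ m = y := by
        intro m
        induction m with
        | zero => simp
        | succ m ih =>
          intro y
          rw [Function.iterate_succ_apply', pow_succ', pow_mul, RingHom.coe_coe,
            frobeniusEquiv_symm_pow_p]
          exact ih y
      exact h n x
  exact DFunLike.congr_fun this a

theorem theta_evalPoly_eq_zero (w : ℕ → O) (hw : ∀ n, w (n + 1) ^ p = w n)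
    {E : (WittVector p k)[X]} (hE : aeval (w 0) E = 0) :
    theta O p (evalPoly (tiltElem w hw) E) = 0 := by
  refine theta_eq_zero_of_forall fun n => ?_
  rw [evalPoly, hom_eval₂, thetaModPPow_teichmuller n _ (w n) (coeff_tiltElem w hw n).symm,
    root_pow_eq w hw]
  have : (thetaModPPow O p n).comp (embWk p k O) =
      (Ideal.Quotient.mk _).comp (algebraMap (WittVector p k) O) :=
    RingHom.ext fun a => thetaModPPow_embWk n a
  rw [this, ← hom_eval₂, ← aeval_def, hE, map_zero]

end Theta
-- Passing from A_cris to A_cris[1/p].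
section Away

/-- If division by `f` along `g : W → A` preserves the image of `W`, and `f` is regular modulo
powers of `q`, then division by `f` preserves the image of `W` in `A[1/q]`. -/
theorem mem_range_of_mul_eq_of_away {W A B : Type*} [CommRing W] [CommRing A] [CommRing B]
    [Algebra A B] (q : ℕ) [IsLocalization.Away (q : A) B] (g : W →+* A) {f : W}
    (hdiv : ∀ α x, g f * α = g x → ∃ y, α = g y ∧ x = f * y)
    (hreg : ∀ (k : ℕ) (y : W), (q : W) ^ k ∣ f * y → (q : W) ^ k ∣ y) {a : B} {x : W}
    (h : algebraMap A B (g f) * a = algebraMap A B (g x)) :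
    ∃ y, algebraMap A B (g y) = a := by
  obtain ⟨K, α, hα⟩ := IsLocalization.Away.surj (q : A) a
  have hcast : ∀ (k : ℕ) (x : W), g (q ^ k * x) = q ^ k * g x := fun k x => by
    rw [map_mul, map_pow, map_natCast]
  have h1 : algebraMap A B (g f * α) = algebraMap A B (g (q ^ K * x)) := by
    rw [hcast, map_mul, map_mul, map_pow, ← hα, ← h]
    ring
  -- Equality after inverting q holds before it only up to a power q^N; this power is absorbed into
  -- x and removed by `hreg`.
  obtain ⟨N, hN⟩ := IsLocalization.Away.exists_of_eq (q : A) h1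
  have h2 : g f * (q ^ N * α) = g (q ^ (N + K) * x) := by
    rw [mul_left_comm, hN, hcast, hcast, pow_add, mul_assoc]
  obtain ⟨y, hy, hxy⟩ := hdiv _ _ h2
  obtain ⟨y', rfl⟩ := hreg (N + K) y (Dvd.intro _ hxy)
  refine ⟨y', ?_⟩
  have hpu : IsUnit (algebraMap A B q ^ (N + K)) :=
    (IsLocalization.Away.algebraMap_isUnit (q : A)).pow _
  apply hpu.mul_right_cancel
  have h4 := congrArg (algebraMap A B) hy
  rw [hcast, map_mul, map_mul, ← hα, map_pow, map_pow] at h4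
  rw [mul_comm, ← h4]
  ring

end Away

/-! ### Division by φ(t) in A_cris and B⁺_cris. -/

section Acris

variable {O : Type v} [CommRing O] {p : ℕ} [hp : Fact p.Prime] [Fact (¬ IsUnit (p : O))]

local notation "φ" => (WittVector.frobenius : WR O p →+* WR O p)

/-- Elements of Ker θ are wξ, whose divided powers are w^n times those of ξ; products of divided
powers of ξ are integer multiples of such powers, so their span is already a ring. -/
theorem mem_AcrisZero_iff {ξ : WR O p} (hker : RingHom.ker (theta O p) = Ideal.span {ξ})
    (z : Localization.Away (p : WR O p)) :
    z ∈ AcrisZero O p ↔ z ∈ divPowSpan (Localization.Away (p : WR O p)) ξ := by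
  have hB := isUnit_factorial_of_away p (PreTilt O p) (Localization.Away (p : WR O p))
  constructor
  · intro hz
    induction hz using Algebra.adjoin_induction with
    | mem z h =>
      obtain ⟨x, hx, n, hz⟩ := h
      rw [hker, Ideal.mem_span_singleton'] at hx
      obtain ⟨w, rfl⟩ := hx
      rw [eq_divPow hB hz, map_mul, divPow_mul, ← map_pow]
      exact algebraMap_mul_mem_divPowSpan _ (divPow_mem_divPowSpan ξ n)
    | algebraMap w => exact algebraMap_mem_divPowSpan ξ w
    | add x y _ _ hx hy => exact Submodule.add_mem _ hx hy
    | mul x y _ _ hx hy => exact mul_mem_divPowSpan hx hy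
  · intro hz
    induction hz using Submodule.span_induction with
    | mem z h =>
      obtain ⟨n, rfl⟩ := h
      refine Algebra.subset_adjoin ⟨ξ, ?_, n, factorial_mul_divPow hB n _⟩
      rw [hker]
      exact Ideal.mem_span_singleton_self ξ
    | zero => exact Subalgebra.zero_mem _
    | add x y _ _ hx hy => exact Subalgebra.add_mem _ hx hy
    | smul w x _ hx => exact Subalgebra.smul_mem _ hx w

variable (O p) in
/-- The canonical map `W(R) → A_cris`. -/
noncomputable def toAcris : WR O p →+* Acris O p :=
  (algebraMap (AcrisZero O p) (Acris O p)).comp (algebraMap (WR O p) (AcrisZero O p))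

theorem evalₐ_toAcris (n : ℕ) (x : WR O p) :
    AdicCompletion.evalₐ (Ideal.span {(p : AcrisZero O p)}) n (toAcris O p x) =
      Ideal.Quotient.mk _ (algebraMap (WR O p) (AcrisZero O p) x) := by
  rw [toAcris, RingHom.comp_apply, AdicCompletion.algebraMap_apply]
  exact AdicCompletion.evalₐ_of _ n _

theorem AcrisZero_dvd_iff {ξ : WR O p} (hker : RingHom.ker (theta O p) = Ideal.span {ξ})
    (n : ℕ) (a : AcrisZero O p) :
    (p : AcrisZero O p) ^ n ∣ a ↔
      ∃ e ∈ divPowSpan (Localization.Away (p : WR O p)) ξ,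
        (a : Localization.Away (p : WR O p)) = p ^ n * e := by
  constructor
  · rintro ⟨e, rfl⟩
    exact ⟨e, (mem_AcrisZero_iff hker _).mp e.2, by push_cast; rfl⟩
  · rintro ⟨e, he, h⟩
    refine ⟨⟨e, (mem_AcrisZero_iff hker _).mpr he⟩, Subtype.ext ?_⟩
    push_cast
    exact h

variable [IsDomain (PreTilt O p)] {ω : PreTilt O p} {ξ η c t : WR O p} (H : IsPeriod ω ξ η c t)
  (hker : RingHom.ker (theta O p) = Ideal.span {ξ}) (hp2 : 2 < p)
include H hker hp2

theorem idealI_eq_span (r : ℕ) : idealI O p r = Ideal.span {φ t ^ r} := by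
  ext x
  rw [Ideal.mem_span_singleton, ← H.forall_pow_dvd_iff hp2 r x, idealI, Ideal.mem_iInf]
  refine forall_congr' fun n => ?_
  rw [Ideal.mem_comap, filW, hker, Ideal.span_singleton_pow, Ideal.mem_span_singleton,
    RingHom.coe_pow]

/-- The integral form of the division statement: Frobenius iterates of approximations show φ(t) ∣ x
in W(R), and injectivity of φ(t) on A_cris identifies the quotient with α. -/
theorem exists_toAcris_eq {α : Acris O p} {x : WR O p}
    (h : toAcris O p (φ t) * α = toAcris O p x) : ∃ y, α = toAcris O p y ∧ x = φ t * y := by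
  obtain ⟨a, ha, hcomp⟩ := exists_adic_representatives (p : AcrisZero O p) α
  have h1 : ∀ i, (p : AcrisZero O p) ^ i ∣
      algebraMap (WR O p) (AcrisZero O p) (φ t) * a i - algebraMap (WR O p) (AcrisZero O p) x := by
    intro i
    have := congrArg (AdicCompletion.evalₐ (Ideal.span {(p : AcrisZero O p)}) i) h
    rw [map_mul, evalₐ_toAcris, evalₐ_toAcris, ha, ← map_mul, ← sub_eq_zero, ← map_sub,
      mk_span_pow_eq_zero] at this
    exact this
  simp only [AcrisZero_dvd_iff hker] at h1 hcomp
  have h2 : ∀ n, ξ ∣ φ^[n] x := by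
    refine H.dvd_frobenius_iterate_of_approx (B := Localization.Away (p : WR O p)) fun i => ?_
    obtain ⟨e, he, h⟩ := h1 i
    refine ⟨a i, -e, Submodule.neg_mem _ he, ?_⟩
    have h' : algebraMap (WR O p) (Localization.Away (p : WR O p)) (φ t) * a i -
        algebraMap (WR O p) (Localization.Away (p : WR O p)) x = p ^ i * e := h
    linear_combination -h'
  obtain ⟨y, rfl⟩ := H.frobenius_t_dvd hp2 h2
  refine ⟨y, ?_, rfl⟩
  rw [← sub_eq_zero]
  refine AdicCompletion.ext_evalₐ fun n => ?_
  rw [map_sub, map_zero, ha, evalₐ_toAcris, ← map_sub, mk_span_pow_eq_zero,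
    AcrisZero_dvd_iff hker]
  refine H.mem_of_frobenius_t_mul_mem hp2 (B := Localization.Away (p : WR O p))
    (fun i => ((a i - algebraMap (WR O p) (AcrisZero O p) y : AcrisZero O p) :
      Localization.Away (p : WR O p))) (fun i j hij => ?_) (fun i => ?_) n
  · obtain ⟨e, he, h⟩ := hcomp i j hij
    refine ⟨e, he, ?_⟩
    rw [← h]
    push_cast
    ring
  · obtain ⟨e, he, h⟩ := h1 i
    refine ⟨e, he, ?_⟩
    rw [← h, map_mul]
    push_cast
    rw [mul_sub]

theorem mem_range_toBcrisPlus_of_mul_mem {a : BcrisPlus O p}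
    (h : toBcrisPlus O p (φ t) * a ∈ Set.range (toBcrisPlus O p)) :
    a ∈ Set.range (toBcrisPlus O p) := by
  obtain ⟨x, hx⟩ := h
  refine mem_range_of_mul_eq_of_away (p : ℕ) (toAcris O p)
    (fun α x => exists_toAcris_eq H hker hp2) (fun k y => ?_) hx.symm
  have hreg : IsRegularMod (p : WR O p) (φ t) := by
    intro z hz
    rw [H.frobenius_eq, mul_assoc, mul_assoc, H.isUnit_c.dvd_mul_left] at hz
    have h3 := H.p_dvd_of_dvd_mul hz
    rw [p_dvd_iff, coeff_zero_mul, mul_eq_zero] at h3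
    rw [p_dvd_iff]
    exact h3.resolve_left fun h => H.not_dvd ((p_dvd_iff t).mpr h)
  exact hreg.pow_dvd (WittVector.p_nonzero p (PreTilt O p)) k

theorem mem_range_toBcrisPlus_of_pow_mul_mem (r : ℕ) {a : BcrisPlus O p}
    (h : toBcrisPlus O p (φ t) ^ r * a ∈ Set.range (toBcrisPlus O p)) :
    a ∈ Set.range (toBcrisPlus O p) := by
  induction r with
  | zero => simpa using h
  | succ r ih =>
    rw [pow_succ', mul_assoc] at h
    exact ih (mem_range_toBcrisPlus_of_mul_mem H hker hp2 h)

end Acris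

/-! ### The period attached to an Eisenstein polynomial. -/

section Eisenstein

theorem exists_eq_X_pow_add_C_mul {A : Type*} [CommRing A] {q : A} {E : A[X]} (hE : E.Monic)
    (hEis : E.IsEisensteinAt (Ideal.span {q})) : ∃ G : A[X], E = X ^ E.natDegree + C q * G := by
  have : C q ∣ E - X ^ E.natDegree := by
    rw [C_dvd_iff_dvd_coeff]
    intro i
    rw [coeff_sub, coeff_X_pow]
    rcases lt_trichotomy i E.natDegree with h | rfl | h
    · rw [if_neg h.ne, sub_zero]
      exact Ideal.mem_span_singleton.mp (hEis.mem h)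
    · rw [if_pos rfl, hE.coeff_natDegree, sub_self]
      exact dvd_zero _
    · rw [if_neg h.ne', coeff_eq_zero_of_natDegree_lt h, sub_zero]
      exact dvd_zero _
  obtain ⟨G, hG⟩ := this
  exact ⟨G, by rw [← hG]; ring⟩

end Eisenstein

section EisensteinPeriod

variable {O : Type v} [CommRing O] [IsDomain O] {p : ℕ} [hp : Fact p.Prime]
  [Fact (¬ IsUnit (p : O))] {L : Type*} [Field L] [Algebra O L] {v : Valuation L NNReal}
  {k : Type u} [Field k] [CharP k p] [PerfectRing k p] [Algebra (WittVector p k) O]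

omit [IsDomain O] [CharP k p] [Fact (¬ IsUnit (p : O))] [PerfectRing k p] in
/-- A root `a` in `O` of an Eisenstein polynomial of degree `e` satisfies `a^e ~ p`. -/
theorem associated_pow_of_isEisensteinAt (hv : v.Integers O) (hpu : ¬ IsUnit (p : O)) {a : O}
    {e : ℕ} (he : e ≠ 0) {G : (WittVector p k)[X]} (hG : IsUnit (G.coeff 0))
    (ha : a ^ e + p * aeval a G = 0) : Associated (a ^ e) (p : O) := by
  have hvp : v (algebraMap O L p) < 1 :=
    lt_of_le_of_ne (hv.map_le_one _) fun h => hpu (hv.isUnit_of_one' h)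
  have ha' : a ^ e = p * -aeval a G := by linear_combination ha
  have hva : v (algebraMap O L a) < 1 := by
    rw [← pow_lt_one_iff_of_nonneg zero_le he, ← map_pow, ← map_pow, ha', map_mul, map_mul]
    exact (mul_le_of_le_one_right zero_le (hv.map_le_one _)).trans_lt hvp
  have hunit : IsUnit (aeval a G) := by
    have h1 : aeval a G = algebraMap (WittVector p k) O (G.coeff 0) + a * aeval a G.divX := by
      conv_lhs => rw [← divX_mul_X_add G]
      rw [map_add, map_mul, aeval_X, aeval_C]; ring
    refine hv.isUnit_of_one' ?_
    rw [h1, map_add]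
    have h2 : v (algebraMap O L (algebraMap (WittVector p k) O (G.coeff 0))) = 1 :=
      hv.one_of_isUnit (hG.map _)
    rw [← h2]
    refine v.map_add_eq_of_lt_left ?_
    rw [h2, map_mul, map_mul]
    exact (mul_le_of_le_one_right zero_le (hv.map_le_one _)).trans_lt hva
  rw [ha']
  exact associated_mul_unit_left _ _ hunit.neg

/-- Write E = u^e + pG. Then η = G([π]) is a unit, because G(0) = c₀ is one and the tilt element
lies in the Jacobson radical. Its e-th power is a root system of an associate of p, so the
divisibility results for the tilt apply to ω. -/
theorem exists_isPeriod (hv : v.Integers O) (hp0 : (p : O) ≠ 0) (ϖ : ℕ → O)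
    (hϖ : ∀ n, ϖ (n + 1) ^ p = ϖ n) {E : (WittVector p k)[X]} (hE : E.Monic)
    (hEis : E.IsEisensteinAt (Ideal.span {(p : WittVector p k)})) (hroot : aeval (ϖ 0) E = 0)
    (c₀ : (WittVector p k)ˣ) (hc₀ : E.coeff 0 = p * c₀) {t : WR O p} (htp : ¬ (p : WR O p) ∣ t)
    (hφt : WittVector.frobenius t = embWk p k O ((c₀⁻¹ : (WittVector p k)ˣ) : WittVector p k) *
      evalPoly (tiltElem ϖ hϖ) E * t) :
    RingHom.ker (theta O p) = Ideal.span {evalPoly (tiltElem ϖ hϖ) E} ∧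
      ∃ η, IsPeriod (tiltElem ϖ hϖ ^ E.natDegree) (evalPoly (tiltElem ϖ hϖ) E) η
        (embWk p k O ((c₀⁻¹ : (WittVector p k)ˣ) : WittVector p k)) t := by
  obtain ⟨G, hG⟩ := exists_eq_X_pow_add_C_mul hE hEis
  have he : E.natDegree ≠ 0 := by
    intro h
    rw [eq_one_of_monic_natDegree_zero hE h, map_one] at hroot
    exact one_ne_zero hroot
  set e := E.natDegree
  have hG0 : G.coeff 0 = c₀ := by
    apply mul_left_cancel₀ (WittVector.p_nonzero p k)
    rw [← hc₀, hG, coeff_add, coeff_X_pow, if_neg he.symm, zero_add, coeff_C_mul]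
  have hassoc : Associated (ϖ 0 ^ e) (p : O) := by
    refine associated_pow_of_isEisensteinAt hv Fact.out he (G := G) (hG0 ▸ c₀.isUnit) ?_
    have := hroot
    rw [hG, map_add, map_mul, map_pow, aeval_X, aeval_C, map_natCast] at this
    exact this
  set x := tiltElem ϖ hϖ with hx
  have hξ : evalPoly x E = WittVector.teichmuller p (x ^ e) + p * evalPoly x G := by
    conv_lhs => rw [hG]
    rw [evalPoly, eval₂_add, eval₂_mul, eval₂_X_pow, eval₂_C, map_natCast, map_pow]
    rfl
  have hξ0 : (evalPoly x E).coeff 0 = x ^ e := by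
    rw [hξ, coeff_zero_add, coeff_zero_p_mul, WittVector.teichmuller_coeff_zero, add_zero]
  have hω0 : PreTilt.coeff 0 (x ^ e) = 0 := by
    rw [map_pow, hx, coeff_tiltElem, ← map_pow, ModP_mk_eq_zero]
    exact hassoc.symm.dvd
  have hjac : x ^ e ∈ (⊥ : Ideal (PreTilt O p)).jacobson := PreTilt_mem_jacobson_of_coeff_zero hω0
  have hxjac : x ∈ (⊥ : Ideal (PreTilt O p)).jacobson := by
    refine Ideal.isRadical_jacobson (I := (⊥ : Ideal (PreTilt O p))) ⟨e, ?_⟩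
    exact hjac
  have hη : IsUnit (evalPoly x G) := by
    have h1 : evalPoly x G = embWk p k O c₀ + WittVector.teichmuller p x * evalPoly x G.divX := by
      conv_lhs => rw [← divX_mul_X_add G]
      rw [evalPoly, eval₂_add, eval₂_mul, eval₂_X, eval₂_C, hG0, evalPoly]; ring
    refine isUnit_of_isUnit_coeff_zero ?_
    rw [h1, coeff_zero_add, coeff_zero_mul, WittVector.teichmuller_coeff_zero]
    obtain ⟨b, hb⟩ := isUnit_coeff_zero (c₀.isUnit.map (embWk p k O))
    have := Ideal.mem_jacobson_bot.mp hxjac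
      ((evalPoly x G.divX).coeff 0 * ((b⁻¹ : (PreTilt O p)ˣ) : PreTilt O p))
    rw [← Units.isUnit_units_mul b] at this
    convert this using 1
    rw [← hb]
    linear_combination (-(x * (evalPoly x G.divX).coeff 0)) * b.mul_inv
  have hpow := tiltElem_pow ϖ hϖ e
  rw [← hx] at hpow
  have hdvd : ∀ y : PreTilt O p, PreTilt.coeff 0 y = 0 → x ^ e ∣ y := fun y hy => by
    rw [hpow]; exact tiltElem_dvd_of_coeff_zero hv _ hassoc hp0 hy
  refine ⟨ker_theta_eq_span hp0 (theta_evalPoly_eq_zero ϖ hϖ hroot) fun y hy => ?_,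
    evalPoly x G, ?_, hjac, fun y hy => ?_, hξ, hη, (c₀⁻¹).isUnit.map _, hφt, htp⟩
  · rw [hξ0]; exact hdvd y hy
  -- If ω were zero, its component 1 would give p ∣ (ϖ 1)^e; the p-th power of this reads p^p ∣ (ϖ
  -- 0)^e ~ p, which is impossible as p is not a unit.
  · intro h0
    have h1 : PreTilt.coeff 1 (x ^ e) = 0 := by rw [h0, map_zero]
    rw [map_pow, hx, coeff_tiltElem, ← map_pow, ModP_mk_eq_zero] at h1
    have h2 : (p : O) * (p : O) ^ (p - 1) ∣ (p : O) * 1 := by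
      rw [← pow_succ', Nat.sub_add_cancel hp.1.pos, mul_one]
      refine (pow_dvd_pow_of_dvd h1 p).trans ?_
      rw [← pow_mul, mul_comm, pow_mul, hϖ]
      exact hassoc.dvd
    rw [mul_dvd_mul_iff_left hp0] at h2
    have h3 : p - 1 ≠ 0 := by have := hp.1.two_le; omega
    exact (Fact.out : ¬ IsUnit (p : O)) (isUnit_of_dvd_one ((dvd_pow_self _ h3).trans h2))
  · rw [hpow] at hy ⊢
    exact tiltElem_dvd_of_almost hv _ hassoc hp0 hy

/-- The main result over an abstract valuation ring `O`. -/
theorem mem_range_and_idealI_eq_span (hv : ∃ v : Valuation L NNReal, v.Integers O)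
    (hp0 : (p : O) ≠ 0) (hp2 : 2 < p) (ϖ : ℕ → O)
    (hϖ : ∀ n, ϖ (n + 1) ^ p = ϖ n) {E : (WittVector p k)[X]} (hE : E.Monic)
    (hEis : E.IsEisensteinAt (Ideal.span {(p : WittVector p k)})) (hroot : aeval (ϖ 0) E = 0)
    (c₀ : (WittVector p k)ˣ) (hc₀ : E.coeff 0 = p * c₀) {t : WR O p} (htp : ¬ (p : WR O p) ∣ t)
    (hφt : WittVector.frobenius t = embWk p k O ((c₀⁻¹ : (WittVector p k)ˣ) : WittVector p k) *
      evalPoly (tiltElem ϖ hϖ) E * t) (r : ℕ) :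
    (∀ a : BcrisPlus O p,
      toBcrisPlus O p (WittVector.frobenius t) ^ r * a ∈ Set.range (toBcrisPlus O p) →
        a ∈ Set.range (toBcrisPlus O p)) ∧
    idealI O p r = Ideal.span {WittVector.frobenius t ^ r} := by
  obtain ⟨v, hv⟩ := hv
  obtain ⟨hker, η, H⟩ := exists_isPeriod hv hp0 ϖ hϖ hE hEis hroot c₀ hc₀ htp hφt
  have := PreTilt.isDomain L v O hv p
  exact ⟨fun a => mem_range_toBcrisPlus_of_pow_mul_mem H hker hp2 r,
    idealI_eq_span H hker hp2 r⟩

end EisensteinPeriod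

/-! ### The ring of integers of the algebraic closure of K. -/

section OKbar

variable (p : ℕ) [Fact p.Prime] (k : Type u) [Field k] [CharP k p] [PerfectRing k p]
  (K : Type v) [Field K] [Algebra (WittVector p k) K] [Algebra (FractionRing (WittVector p k)) K]
  [IsScalarTower (WittVector p k) (FractionRing (WittVector p k)) K]

theorem exists_valuation_integers_OKbar [FiniteDimensional (FractionRing (WittVector p k)) K] :
    ∃ v : Valuation (AlgebraicClosure K) NNReal, v.Integers (OKbar p k K) := by
  have h := fun q hq i => @exists_valuation_integers_integralClosure (WittVector p k)
    (FractionRing (WittVector p k)) (AlgebraicClosure K) _ _ _ _ _ _ _ _ _ _ _ q hq i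
  exact h p (WittVector.irreducible p) inferInstance

omit [PerfectRing k p] in
theorem natCast_p_OKbar_ne_zero : (p : OKbar p k K) ≠ 0 := by
  have hinj : Function.Injective (algebraMap (WittVector p k) (AlgebraicClosure K)) := by
    rw [IsScalarTower.algebraMap_eq (WittVector p k) (FractionRing (WittVector p k))
      (AlgebraicClosure K)]
    exact (algebraMap (FractionRing (WittVector p k)) (AlgebraicClosure K)).injective.comp
      (IsFractionRing.injective _ _)
  intro h
  have h1 : (p : AlgebraicClosure K) = 0 := congrArg Subtype.val h
  rw [← map_natCast (algebraMap (WittVector p k) (AlgebraicClosure K)),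
    ← map_zero (algebraMap (WittVector p k) (AlgebraicClosure K))] at h1
  exact WittVector.p_nonzero p k (hinj h1)

end OKbar

end PadicHodge

theorem lemma3p4 {p : ℕ} [Fact p.Prime] (hp : 2 < p)
    -- a perfect field `k` of characteristic `p`, and a finite extension `K` of `K₀ = Frac W(k)`
    {k : Type u} [Field k] [CharP k p] [PerfectRing k p]
    {K : Type v} [Field K] [Algebra (WittVector p k) K]
    [Algebra (FractionRing (WittVector p k)) K]
    [IsScalarTower (WittVector p k) (FractionRing (WittVector p k)) K]
    [FiniteDimensional (FractionRing (WittVector p k)) K]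
    -- a uniformiser `π` of `K`; total ramification, that is, `e(K/K₀) = [K : K₀]`
    (π : integralClosure (WittVector p k) K) (hπ : Irreducible π)
    (hram : Associated (p : integralClosure (WittVector p k) K)
      (π ^ Module.finrank (FractionRing (WittVector p k)) K))
    -- the Eisenstein polynomial `E(u)` of `π`, with constant term `p c₀`
    (E : (WittVector p k)[X]) (hE : E.Monic)
    (hEis : E.IsEisensteinAt (Ideal.span {(p : WittVector p k)})) (hEπ : aeval π E = 0)
    (c₀ : (WittVector p k)ˣ) (hc₀ : E.coeff 0 = p * c₀)
    -- a compatible system `(π_n)` of `p`-power roots of `π` in the algebraic closure of `K`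
    (ϖ : ℕ → PadicHodge.OKbar p k K)
    (hϖ₀ : (ϖ 0 : AlgebraicClosure K) = algebraMap K (AlgebraicClosure K) π)
    (hϖ : ∀ n, ϖ (n + 1) ^ p = ϖ n)
    -- the element `𝔱` of `𝔖^ur`, not divisible by `p`, with `φ(𝔱) = c₀⁻¹ E(u) 𝔱`
    (t : PadicHodge.WR (PadicHodge.OKbar p k K) p)
    (ht : t ∈ PadicHodge.Sur p k (PadicHodge.tiltElem ϖ hϖ))
    (htp : ¬ (p : PadicHodge.WR (PadicHodge.OKbar p k K) p) ∣ t)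
    (hφt : WittVector.frobenius t =
      PadicHodge.embWk p k (PadicHodge.OKbar p k K) ((c₀⁻¹ : (WittVector p k)ˣ) : WittVector p k) *
        PadicHodge.evalPoly (PadicHodge.tiltElem ϖ hϖ) E * t)
    (r : ℕ) :
    (∀ a : PadicHodge.BcrisPlus (PadicHodge.OKbar p k K) p,
      PadicHodge.toBcrisPlus (PadicHodge.OKbar p k K) p (WittVector.frobenius t) ^ r * a ∈
          Set.range (PadicHodge.toBcrisPlus (PadicHodge.OKbar p k K) p) →
        a ∈ Set.range (PadicHodge.toBcrisPlus (PadicHodge.OKbar p k K) p)) ∧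
    PadicHodge.idealI (PadicHodge.OKbar p k K) p r =
      Ideal.span {WittVector.frobenius t ^ r} := by
  have hroot : aeval (ϖ 0) E = 0 := by
    apply Subtype.val_injective
    have h1 : ((aeval (ϖ 0) E : PadicHodge.OKbar p k K) : AlgebraicClosure K) =
        aeval (ϖ 0 : AlgebraicClosure K) E :=
      (aeval_algebraMap_apply (AlgebraicClosure K) (ϖ 0) E).symm
    have h2 : aeval (π : K) E = 0 := by
      have := aeval_algebraMap_apply K π E
      rw [hEπ, map_zero] at this
      exact this
    rw [h1, hϖ₀, aeval_algebraMap_apply, h2, map_zero]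
    rfl
  exact PadicHodge.mem_range_and_idealI_eq_span (L := AlgebraicClosure K)
    (PadicHodge.exists_valuation_integers_OKbar p k K)
    (PadicHodge.natCast_p_OKbar_ne_zero p k K) hp ϖ hϖ hE hEis hroot c₀ hc₀ htp hφt r
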